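/- Let $V=\mathbb{R}^d$ and let $\|\cdot\|_k$ be norms on the tensor powers $V^{\otimes k}$, $k\ge 0$, that are compatible with the tensor product, i.e. $\|\xi\otimes\eta\|_{k+l}\le\|\xi\|_k\|\eta\|_l$. Let $1/3<\beta<1/2$, $T>0$ and $p=1/\beta$. Let $\mathbf{y}_{s,t}=(1,\mathbf{y}^1_{s,t},\mathbf{y}^2_{s,t})$, $0\le s\le t\le T$, with values in $T^2(V)=\mathbb{R}\oplus V\oplus V^{\otimes 2}$, be a geometric $\beta$-Hölder rough path lying above a path $y:[0,T]\to V$. That is: $\mathbf{y}^1_{s,t}=y_t-y_s$; there is a constant $C$ such that $$\|\mathbf{y}^i_{s,t}\|_i\le C(t-s)^{i\beta},\qquad i=1,2,\quad 0\le s\le t\le T;$$ and there are continuous paths $y(m)$ of finite variation on $[0,T]$, whose iterated integrals of orders $1$ and $2$ are denoted $\mathbf{y}(m)^1,\mathbf{y}(m)^2$, such that $d_p(\mathbf{y}(m),\mathbf{y})\to 0$, where $$d_p(\mathbf{x},\mathbf{y})=\sup_{1\le i\le 2}\ \sup_{0=t_0\le\cdots\le t_n=T}\Big(\sum_{l}\|\mathbf{x}^i_{t_{l-1},t_l}-\mathbf{y}^i_{t_{l-1},t_l}\|_i^{p/i}\Big)^{i/p}.$$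 Fix any constant $C$ for which the displayed Hölder estimate holds. Then $\mathbf{y}$ has a unique Lyons extension, that is, there is a unique family $(\mathbf{y}^k_{s,t})_{k\ge 0,\,0\le s\le t\le T}$, $\mathbf{y}^k_{s,t}\in V^{\otimes k}$, which extends the given levels $k\le 2$, satisfies Chen's identity $\mathbf{y}^k_{s,t}=\sum_{j=0}^k\mathbf{y}^j_{s,u}\otimes\mathbf{y}^{k-j}_{u,t}$ for all $k\ge 0$ and $0\le s\le u\le t\le T$, and has finite $p$-variation at every level: for each $k\ge1$ there is a control $\omega$ (a continuous, non-negative, superadditive function on $\{0\le s\le t\le T\}$ vanishing on the diagonal) with $\|\mathbf{y}^k_{s,t}\|_k\le\omega(s,t)^{k\beta}$. Moreover, for every $k\ge 1$ and every $0<t\le T$, $$\|\mathbf{y}^{k}_{0,t}\|_k\le\frac{\big[(KT)^{\beta}\big]^{k}}{\alpha\,\Gamma(k\beta)},$$ where $$\alpha=\frac1{\beta^2}\Big(1+\sum_{r=3}^{\infty}\Big(\frac{2}{r-2}\Big)^{3\beta}\Big),\qquad K=\max\Big\{(\alpha\,\Gamma(\beta)\,C)^{1/\beta},\ (\alpha\,\Gamma(2\beta)\,C)^{1/(2\beta)}\Big\}.$$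 -/

import Mathlib

open Set Filter Topology
open scoped ENNReal

noncomputable section

namespace RoughTaylor

/-- The tensor power `(ℝ^d)^{⊗k}` in coordinates: `ξ w` is the coefficient of
`e_{w 0} ⊗ ⋯ ⊗ e_{w (k-1)}`. -/
abbrev Tensor (d k : ℕ) : Type := (Fin k → Fin d) → ℝ

/-- The tensor product `(ℝ^d)^{⊗k} × (ℝ^d)^{⊗l} → (ℝ^d)^{⊗(k+l)}`. -/
def tmul {d k l : ℕ} (ξ : Tensor d k) (η : Tensor d l) : Tensor d (k + l) :=
  fun w => ξ (fun i => w (Fin.castAdd l i)) * η (fun i => w (Fin.natAdd k i))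

/-- The truncated tensor algebra `T^n(ℝ^d) = ℝ ⊕ ℝ^d ⊕ ⋯ ⊕ (ℝ^d)^{⊗n}`. -/
abbrev TruncTensor (d n : ℕ) : Type := (k : Fin (n + 1)) → Tensor d k

/-- The algebra of tensor series `T((ℝ^d)) = ∏_{k ≥ 0} (ℝ^d)^{⊗k}`. -/
abbrev TensorSeries (d : ℕ) : Type := (k : ℕ) → Tensor d k

/-- Truncation of a tensor series at level `n`. -/
def TensorSeries.trunc {d : ℕ} (n : ℕ) (ξ : TensorSeries d) : TruncTensor d n :=
  fun k => ξ k

/-- The product of tensor series, `(ξ ⊗ η)^k = ∑_{j=0}^k ξ^j ⊗ η^{k-j}`. -/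
def TensorSeries.mul {d : ℕ} (ξ η : TensorSeries d) : TensorSeries d :=
  fun k w => ∑ j : Fin (k + 1),
    tmul (ξ j) (η (k - j)) (fun i => w (Fin.cast (by have := j.isLt; omega) i))

/-- A family of norms on the tensor powers of `ℝ^d` that is compatible with the tensor product. -/
structure CompatibleNorms {d : ℕ} (N : ∀ k, Seminorm ℝ (Tensor d k)) : Prop where
  eq_zero : ∀ k (ξ : Tensor d k), N k ξ = 0 → ξ = 0
  tmul_le : ∀ k l (ξ : Tensor d k) (η : Tensor d l), N (k + l) (tmul ξ η) ≤ N k ξ * N l η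

/-- The Riemann–Stieltjes integral `∫_a^b f dg` exists (as a limit of tagged Riemann–Stieltjes
sums over partitions of `[a, b]` whose mesh tends to zero) and is equal to `I`. -/
def HasRSIntegral (f g : ℝ → ℝ) (a b I : ℝ) : Prop :=
  ∀ ε > 0, ∃ δ > 0, ∀ (n : ℕ) (u : Fin (n + 1) → ℝ) (ξ : Fin n → ℝ),
    Monotone u → u 0 = a → u (Fin.last n) = b →
    (∀ i : Fin n, u i.succ - u i.castSucc < δ ∧ ξ i ∈ Icc (u i.castSucc) (u i.succ)) →
    |∑ i : Fin n, f (ξ i) * (g (u i.succ) - g (u i.castSucc)) - I| < ε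

/-- `S` is the family of iterated integrals of `x` over `[0, T]`: for `0 ≤ s ≤ t ≤ T`,
`S^k_{s,t} = ∫_{s < t_1 < ⋯ < t_k < t} dx_{t_1} ⊗ ⋯ ⊗ dx_{t_k}`, that is, `S^0 = 1` and
`S^{k+1,(w,i)}_{s,t} = ∫_s^t S^{k,w}_{s,u} dx^i_u`. -/
def IsSignature {d : ℕ} (T : ℝ) (x : ℝ → EuclideanSpace ℝ (Fin d))
    (S : ℝ → ℝ → TensorSeries d) : Prop :=
  ∀ s t, 0 ≤ s → s ≤ t → t ≤ T →
    (∀ w, S s t 0 w = 1) ∧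
    ∀ (k : ℕ) (w : Fin k → Fin d) (i : Fin d),
      HasRSIntegral (fun u => S s u k w) (fun u => x u i) s t (S s t (k + 1) (Fin.snoc w i))

/-- `rx` is the smooth rough path in `T^n(ℝ^d)` associated with the continuous path of finite
variation `x` on `[0, T]`. -/
def IsSmoothRoughPath {d : ℕ} (n : ℕ) (T : ℝ) (x : ℝ → EuclideanSpace ℝ (Fin d))
    (rx : ℝ → ℝ → TruncTensor d n) : Prop :=
  ContinuousOn x (Icc 0 T) ∧ BoundedVariationOn x (Icc 0 T) ∧
    ∃ S : ℝ → ℝ → TensorSeries d, IsSignature T x S ∧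
      ∀ s t, 0 ≤ s → s ≤ t → t ≤ T → rx s t = (S s t).trunc n

/-- The `p`-variation distance
`sup_{1 ≤ i ≤ n} sup_D (∑_l ‖rx^i_{t_{l-1},t_l} - ry^i_{t_{l-1},t_l}‖^{p/i})^{i/p}`, where `D` runs
over the partitions `0 = t_0 ≤ ⋯ ≤ t_m = T` of `[0, T]`. -/
def pVarDist {d n : ℕ} (N : ∀ k, Seminorm ℝ (Tensor d k)) (p T : ℝ)
    (rx ry : ℝ → ℝ → TruncTensor d n) : ℝ≥0∞ :=
  ⨆ (i : Fin (n + 1)) (_ : 1 ≤ (i : ℕ)) (m : ℕ) (u : Fin (m + 1) → ℝ)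
    (_ : Monotone u ∧ u 0 = 0 ∧ u (Fin.last m) = T),
    (∑ l : Fin m, ENNReal.ofReal
      (N i (rx (u l.castSucc) (u l.succ) i - ry (u l.castSucc) (u l.succ) i)) ^ (p / (i : ℝ))) ^
        ((i : ℝ) / p)

/-- The Hölder estimate `‖ry^i_{s,t}‖ ≤ C (t - s)^{iβ}` for `1 ≤ i ≤ n` and `0 ≤ s ≤ t ≤ T`. -/
def HolderEstimate {d n : ℕ} (N : ∀ k, Seminorm ℝ (Tensor d k)) (β T C : ℝ)
    (ry : ℝ → ℝ → TruncTensor d n) : Prop :=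
  ∀ i : Fin (n + 1), 1 ≤ (i : ℕ) → ∀ s t, 0 ≤ s → s ≤ t → t ≤ T →
    N i (ry s t i) ≤ C * (t - s) ^ ((i : ℝ) * β)

/-- `ry` is a geometric `β`-Hölder rough path on `[0, T]` lying above the path `y`. (The
conditions `level_one` and `holder` make `y` a `β`-Hölder path.) -/
structure IsGeometricHolderRoughPath {d : ℕ} (N : ∀ k, Seminorm ℝ (Tensor d k)) (β T : ℝ)
    (y : ℝ → EuclideanSpace ℝ (Fin d)) (ry : ℝ → ℝ → TruncTensor d ⌊1 / β⌋₊) : Prop where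
  level_zero : ∀ s t, 0 ≤ s → s ≤ t → t ≤ T → ∀ w, ry s t 0 w = 1
  level_one : ∀ i : Fin (⌊1 / β⌋₊ + 1), (i : ℕ) = 1 → ∀ s t, 0 ≤ s → s ≤ t → t ≤ T →
    ∀ (w : Fin i → Fin d) (j : Fin i), ry s t i w = y t (w j) - y s (w j)
  holder : ∃ C : ℝ, HolderEstimate N β T C ry
  geometric : ∃ (x : ℕ → ℝ → EuclideanSpace ℝ (Fin d))
    (rx : ℕ → ℝ → ℝ → TruncTensor d ⌊1 / β⌋₊),
    (∀ m, IsSmoothRoughPath ⌊1 / β⌋₊ T (x m) (rx m)) ∧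
      Tendsto (fun m => pVarDist N (1 / β) T (rx m) ry) atTop (𝓝 0)

/-- `ω` is a control on `{(s, t) : 0 ≤ s ≤ t ≤ T}`: non-negative, continuous, superadditive and
zero on the diagonal. -/
structure IsControl (T : ℝ) (ω : ℝ → ℝ → ℝ) : Prop where
  nonneg : ∀ s t, 0 ≤ s → s ≤ t → t ≤ T → 0 ≤ ω s t
  continuousOn : ContinuousOn (fun q : ℝ × ℝ => ω q.1 q.2) {q | 0 ≤ q.1 ∧ q.1 ≤ q.2 ∧ q.2 ≤ T}
  diag : ∀ t, 0 ≤ t → t ≤ T → ω t t = 0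
  superadditive : ∀ s u t, 0 ≤ s → s ≤ u → u ≤ t → t ≤ T → ω s u + ω u t ≤ ω s t

/-- `Y` is a Lyons extension of the rough path `ry` (of finite `1/β`-variation) to all levels:
it extends `ry`, satisfies Chen's identity at every level, and each level has finite
`1/β`-variation controlled by some control. -/
structure IsLyonsExtension {d n : ℕ} (N : ∀ k, Seminorm ℝ (Tensor d k)) (β T : ℝ)
    (ry : ℝ → ℝ → TruncTensor d n) (Y : ℝ → ℝ → TensorSeries d) : Prop where
  extends_path : ∀ s t, 0 ≤ s → s ≤ t → t ≤ T → (Y s t).trunc n = ry s t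
  chen : ∀ s u t, 0 ≤ s → s ≤ u → u ≤ t → t ≤ T → (Y s u).mul (Y u t) = Y s t
  finite_variation : ∀ k, 1 ≤ k → ∃ ω : ℝ → ℝ → ℝ, IsControl T ω ∧
    ∀ s t, 0 ≤ s → s ≤ t → t ≤ T → N k (Y s t k) ≤ ω s t ^ ((k : ℝ) * β)

/-- `α = β⁻² (1 + ∑_{r=3}^∞ (2/(r-2))^{3β})`; the sum is written with `r = q + 3`. -/
def alphaConst (β : ℝ) : ℝ :=
  1 / β ^ 2 * (1 + ∑' q : ℕ, (2 / ((q : ℝ) + 1)) ^ (3 * β))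

/-- `K = max {(α Γ(β) C)^{1/β}, (α Γ(2β) C)^{1/(2β)}}`. -/
def KConst (β C : ℝ) : ℝ :=
  max ((alphaConst β * Real.Gamma β * C) ^ (1 / β))
    ((alphaConst β * Real.Gamma (2 * β) * C) ^ (1 / (2 * β)))

end RoughTaylor

end

noncomputable section

namespace RoughTaylor

/-! The extension is built one level at a time. Suppose the levels below k ≥ 3 are multiplicative.
Chen's identity at level k asks for Z with Z_{s,t} = D_{s,u,t} + Z_{s,u} + Z_{u,t}, where D collects
the mixed tensor products of lower levels. By associativity D is a coboundary: minus the level k of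
Y_{0,s} ⊗ Y_{s,t}, computed with zero entries at level k, is a solution (`update_level_chen`), and
increments φ_t - φ_s may be added to it. Since θ = kβ > 1 and D = O((t-s)^θ), the sewing lemma,
proved by compactness from finite sets of points, provides a φ for which Z = O((t-s)^θ). Bisection
at midpoints then replaces the constant by one free of norm-equivalence factors (`exists_cochain`).

For the bounds to reproduce themselves with the same α, the coefficients 1/Γ(kβ), awkward to
convolve, are traded for c_k = 4(kβ+1)^{-(kβ+1)}. These dominate 1/Γ(kβ) when kβ ≤ 1 and are
dominated by it when kβ ≥ 1. So the Hölder estimate on levels 1 and 2 starts the induction, and its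
outcome on levels k ≥ 3 implies the Gamma bound. Convexity of x log x controls c_j c_{k-j} uniformly
in j, and `compCoeff_conv_le` shows that α is large enough to close the induction.

On levels up to two, Chen's identity holds for iterated integrals and passes to the limit
(`toSeries_chen`). For uniqueness, extensions agreeing below level k differ there by an additive
function of intervals bounded by a power greater than one of a control, which vanishes
(`additive_eq_zero`). -/

/-! ### Algebra of tensor series, through functions on words. -/

/-- The convolution (concatenation) product of functions on words. -/
def wordConv {A : Type*} (f g : List A → ℝ) : List A → ℝ
  | [] => f [] * g []
  | a :: l => f [] * g (a :: l) + wordConv (fun v => f (a :: v)) g l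

/-- In the inductive step of associativity the left factor becomes `f [] * g (a :: v)` plus a
convolution, which is a combination of exactly this shape. -/
theorem wordConv_linear_left {A : Type*} (c : ℝ) (f f' g : List A → ℝ) (l : List A) :
    wordConv (fun v => c * f v + f' v) g l = c * wordConv f g l + wordConv f' g l := by
  induction l generalizing f f' with
  | nil => simp only [wordConv]; ring
  | cons a l ih => simp only [wordConv, ih]; ring

theorem wordConv_assoc {A : Type*} (f g h : List A → ℝ) (l : List A) :
    wordConv (wordConv f g) h l = wordConv f (wordConv g h) l := by
  induction l generalizing f with
  | nil => simp only [wordConv]; ring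
  | cons a l ih =>
    simp only [wordConv, wordConv_linear_left, ih]
    ring

theorem wordConv_eq_sum {A : Type*} (f g : List A → ℝ) (l : List A) :
    wordConv f g l = ∑ i ∈ Finset.range (l.length + 1), f (l.take i) * g (l.drop i) := by
  induction l generalizing f with
  | nil => simp [wordConv]
  | cons a l ih =>
    rw [List.length_cons, Finset.sum_range_succ']
    simp only [wordConv, ih, List.take_succ_cons, List.drop_succ_cons, List.take_zero,
      List.drop_zero]
    ring

/-- A tensor series as a function on words. -/
def TensorSeries.toWord {d : ℕ} (ξ : TensorSeries d) (l : List (Fin d)) : ℝ :=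
  ξ l.length l.get

theorem toWord_eq {d : ℕ} (ξ : TensorSeries d) (l : List (Fin d)) (k : ℕ) (h : l.length = k) :
    ξ.toWord l = ξ k (fun i => l.get (Fin.cast h.symm i)) := by
  subst h; rfl

theorem toWord_ofFn {d : ℕ} (ξ : TensorSeries d) {k : ℕ} (w : Fin k → Fin d) :
    ξ.toWord (List.ofFn w) = ξ k w := by
  rw [toWord_eq ξ _ k (List.length_ofFn)]
  congr 1
  ext i
  simp

/-- The summand `ξ^j ⊗ η^{k-j}` of the level `k` of the product of two tensor series. -/
def mulTerm {d : ℕ} (ξ η : TensorSeries d) (k j : ℕ) : Tensor d k :=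
  fun w => ξ.toWord ((List.ofFn w).take j) * η.toWord ((List.ofFn w).drop j)

theorem mulTerm_eq_tmul {d : ℕ} (ξ η : TensorSeries d) (k j : ℕ) (hj : j ≤ k) (w : Fin k → Fin d) :
    mulTerm ξ η k j w = tmul (ξ j) (η (k - j)) (fun i => w (Fin.cast (by omega) i)) := by
  unfold mulTerm tmul
  rw [toWord_eq ξ _ j (by simp [hj]), toWord_eq η _ (k - j) (by simp)]
  congr 2
  · ext i; simp; rfl
  · ext i; simp; rfl

theorem mul_apply {d : ℕ} (ξ η : TensorSeries d) (k : ℕ) :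
    ξ.mul η k = ∑ j ∈ Finset.range (k + 1), mulTerm ξ η k j := by
  ext w
  rw [Finset.sum_apply, ← Fin.sum_univ_eq_sum_range (fun j => mulTerm ξ η k j w)]
  unfold TensorSeries.mul
  refine Finset.sum_congr rfl fun j _ => ?_
  rw [mulTerm_eq_tmul _ _ _ _ (by omega)]

theorem toWord_mul {d : ℕ} (ξ η : TensorSeries d) (l : List (Fin d)) :
    (ξ.mul η).toWord l = wordConv ξ.toWord η.toWord l := by
  rw [wordConv_eq_sum, TensorSeries.toWord, mul_apply, Finset.sum_apply]
  refine Finset.sum_congr rfl fun j _ => ?_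
  unfold mulTerm
  rw [List.ofFn_get]

theorem mul_assoc' {d : ℕ} (ξ η ζ : TensorSeries d) :
    (ξ.mul η).mul ζ = ξ.mul (η.mul ζ) := by
  funext k w
  rw [← toWord_ofFn ((ξ.mul η).mul ζ), ← toWord_ofFn (ξ.mul (η.mul ζ)), toWord_mul, toWord_mul, funext (toWord_mul ξ η),
    funext (toWord_mul η ζ), wordConv_assoc]

theorem mulTerm_congr {d : ℕ} {ξ ξ' η η' : TensorSeries d} {k j : ℕ} (hj : j ≤ k)
    (h : ξ j = ξ' j) (h' : η (k - j) = η' (k - j)) : mulTerm ξ η k j = mulTerm ξ' η' k j := by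
  ext w
  rw [mulTerm_eq_tmul _ _ _ _ hj, mulTerm_eq_tmul _ _ _ _ hj, h, h']

theorem mulTerm_self {d : ℕ} {ξ η : TensorSeries d} {k : ℕ} (h : ∀ w, η 0 w = 1) :
    mulTerm ξ η k k = ξ k := by
  ext w
  unfold mulTerm
  rw [List.take_of_length_le (by simp), toWord_ofFn, toWord_eq η _ 0 (by simp), h, mul_one]

theorem mulTerm_zero {d : ℕ} {ξ η : TensorSeries d} {k : ℕ} (h : ∀ w, ξ 0 w = 1) :
    mulTerm ξ η k 0 = η k := by
  ext w
  unfold mulTerm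
  rw [List.drop_zero, toWord_ofFn, toWord_eq ξ _ 0 (by simp), h, one_mul]

/-- As the scalar part of the right factor is 1, the top level of the left factor enters additively.
This lets a correction at level k be read off from a product. -/
theorem mul_change_left {d : ℕ} {ξ ξ' η : TensorSeries d} {k : ℕ} (hη : ∀ w, η 0 w = 1)
    (h : ∀ j < k, ξ j = ξ' j) : ξ.mul η k = ξ'.mul η k + (ξ k - ξ' k) := by
  rw [mul_apply, mul_apply, Finset.sum_range_succ, Finset.sum_range_succ, mulTerm_self hη,
    mulTerm_self hη, Finset.sum_congr rfl (fun j hj => ?_)]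
  · abel
  · rw [Finset.mem_range] at hj
    exact mulTerm_congr hj.le (h j hj) rfl

theorem mul_change_right {d : ℕ} {ξ η η' : TensorSeries d} {k : ℕ} (hξ : ∀ w, ξ 0 w = 1)
    (h : ∀ j < k, η j = η' j) : ξ.mul η k = ξ.mul η' k + (η k - η' k) := by
  rw [mul_apply, mul_apply, Finset.sum_range_succ', Finset.sum_range_succ', mulTerm_zero hξ,
    mulTerm_zero hξ, Finset.sum_congr rfl (fun j hj => ?_)]
  · abel
  · rw [Finset.mem_range] at hj
    exact mulTerm_congr hj rfl (h _ (by omega))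

theorem mul_zero_level {d : ℕ} {ξ η : TensorSeries d} (hξ : ∀ w, ξ 0 w = 1)
    (hη : ∀ w, η 0 w = 1) (w : Fin 0 → Fin d) : ξ.mul η 0 w = 1 := by
  rw [mul_apply, Finset.sum_range_one, mulTerm_zero hξ, hη]

theorem seminorm_mulTerm_le {d : ℕ} {N : ∀ k, Seminorm ℝ (Tensor d k)} (hN : CompatibleNorms N)
    (ξ η : TensorSeries d) {k j : ℕ} (hj : j ≤ k) :
    N k (mulTerm ξ η k j) ≤ N j (ξ j) * N (k - j) (η (k - j)) := by
  obtain ⟨l, rfl⟩ := Nat.exists_eq_add_of_le hj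
  have : mulTerm ξ η (j + l) j = tmul (ξ j) (η l) := by
    ext w
    have hl : j + l - j = l := by omega
    unfold mulTerm tmul
    rw [toWord_eq ξ _ j (by simp), toWord_eq η _ l (by simp)]
    congr 2
    · ext i; simp; rfl
    · ext i; simp; rfl
  rw [this, Nat.add_sub_cancel_left]
  exact hN.tmul_le j l _ _

/-- The level `k` of a product, when the level `k` of both factors is zero. -/
theorem seminorm_mul_le {d : ℕ} {N : ∀ k, Seminorm ℝ (Tensor d k)} (hN : CompatibleNorms N)
    {ξ η : TensorSeries d} {k : ℕ} (hξ : ∀ w, ξ 0 w = 1) (hη : ∀ w, η 0 w = 1)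
    (hξk : ξ k = 0) (hηk : η k = 0) :
    N k (ξ.mul η k) ≤ ∑ j ∈ Finset.Ico 1 k, N j (ξ j) * N (k - j) (η (k - j)) := by
  have h : ξ.mul η k = ∑ j ∈ Finset.Ico 1 k, mulTerm ξ η k j := by
    rw [mul_apply, Finset.sum_range_succ, mulTerm_self hη, hξk, add_zero]
    rcases Nat.eq_zero_or_pos k with rfl | hk
    · simp
    · rw [Finset.range_eq_Ico, Finset.sum_eq_sum_Ico_succ_bot hk, mulTerm_zero hξ, hηk, zero_add]
  rw [h]
  refine (Finset.le_sum_of_subadditive (N k) (map_zero _).le (map_add_le_add _) _ _).trans (Finset.sum_le_sum fun j hj => ?_)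
  rw [Finset.mem_Ico] at hj
  exact seminorm_mulTerm_le hN ξ η hj.2.le

/-! ### The additive sewing lemma. -/

theorem two_mul_half_rpow {h θ : ℝ} (hh : 0 ≤ h) : 2 * (h / 2) ^ θ = 2 ^ (1 - θ) * h ^ θ := by
  rw [Real.div_rpow hh (by norm_num), Real.rpow_sub (by norm_num), Real.rpow_one]
  ring

theorem two_rpow_one_sub_lt_one {θ : ℝ} (hθ : 1 < θ) : (2 : ℝ) ^ (1 - θ) < 1 :=
  Real.rpow_lt_one_of_one_lt_of_neg (by norm_num) (by linarith)

theorem exists_crossing {v : ℕ → ℝ} {a b : ℕ} {c : ℝ} (hab : a < b) (ha : v a ≤ c)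
    (hb : c ≤ v b) : ∃ m, a ≤ m ∧ m < b ∧ v m ≤ c ∧ c ≤ v (m + 1) := by
  classical
  have hex : ∃ i, a < i ∧ c ≤ v i := ⟨b, hab, hb⟩
  obtain ⟨h1, h2⟩ := Nat.find_spec hex
  have h3 : Nat.find hex ≤ b := Nat.find_min' hex ⟨hab, hb⟩
  obtain ⟨m, hm⟩ : ∃ m, Nat.find hex = m + 1 := ⟨Nat.find hex - 1, by omega⟩
  have h4 := Nat.find_min hex (m := m) (by omega)
  rw [hm] at h1 h2 h3
  refine ⟨m, by omega, by omega, ?_, h2⟩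
  rcases Nat.eq_or_lt_of_le (Nat.lt_succ_iff.mp h1) with rfl | h5
  · exact ha
  · exact (not_le.mp fun h => h4 ⟨h5, h⟩).le

section Sewing

variable {E : Type*} [NormedAddCommGroup E] {Ξ : ℝ → ℝ → E} {M θ T : ℝ}

/-- Strong induction on the number of steps: removing the step that crosses the midpoint leaves two
pieces of length at most half. The two removals cost 2M in total, and K = 2M / (1 - 2^(1-θ)) solves
K 2^(1-θ) + 2M = K. -/
theorem sewing_sum_le (hθ : 1 < θ)
    (hΞ : ∀ s u t, 0 ≤ s → s ≤ u → u ≤ t → t ≤ T → ‖Ξ s t - Ξ s u - Ξ u t‖ ≤ M * (t - s) ^ θ)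
    {v : ℕ → ℝ} (hv : Monotone v) (hv' : ∀ i, v i ∈ Icc 0 T) (n : ℕ) :
    ∀ a b, b = a + n → ‖∑ i ∈ Finset.Ico a b, Ξ (v i) (v (i + 1)) - Ξ (v a) (v b)‖ ≤
      2 * M / (1 - 2 ^ (1 - θ)) * (v b - v a) ^ θ := by
  have hr := two_rpow_one_sub_lt_one hθ
  induction n using Nat.strong_induction_on with
  | _ n ih =>
    rintro a b rfl
    rcases Nat.eq_zero_or_pos n with rfl | hn
    · have h := hΞ (v a) (v a) (v a) (hv' a).1 le_rfl le_rfl (hv' a).2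
      have h0 : (0 : ℝ) ^ θ = 0 := Real.zero_rpow (by linarith)
      simp only [sub_self, zero_sub, norm_neg, h0, mul_zero] at h
      simpa [h0] using h
    · have hab : v a ≤ v (a + n) := hv (by omega)
      obtain ⟨m, h1, h2, h3, h4⟩ := exists_crossing (v := v) (c := (v a + v (a + n)) / 2)
        (show a < a + n by omega) (by linarith) (by linarith)
      have i1 := ih (m - a) (by omega) a m (by omega)
      have i2 := ih (a + n - (m + 1)) (by omega) (m + 1) (a + n) (by omega)
      have d1 := hΞ (v a) (v m) (v (a + n)) (hv' a).1 (hv h1) (hv h2.le) (hv' _).2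
      have d2 := hΞ (v m) (v (m + 1)) (v (a + n)) (hv' m).1 (hv (by omega)) (hv h2) (hv' _).2
      have hs : ∑ i ∈ Finset.Ico a (a + n), Ξ (v i) (v (i + 1)) =
          ∑ i ∈ Finset.Ico a m, Ξ (v i) (v (i + 1)) + (Ξ (v m) (v (m + 1)) +
            ∑ i ∈ Finset.Ico (m + 1) (a + n), Ξ (v i) (v (i + 1))) := by
        rw [← Finset.sum_Ico_consecutive _ h1 h2.le, Finset.sum_eq_sum_Ico_succ_bot h2]
      set S1 := ∑ i ∈ Finset.Ico a m, Ξ (v i) (v (i + 1))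
      set S2 := ∑ i ∈ Finset.Ico (m + 1) (a + n), Ξ (v i) (v (i + 1))
      set h := v (a + n) - v a with hh
      have hh0 : 0 ≤ h := by linarith
      have hM : 0 ≤ M * h ^ θ := (norm_nonneg _).trans d1
      -- No sign of M is assumed. If h ^ θ = 0, all the points coincide and Ξ vanishes on the
      -- diagonal.
      have hM' : 0 ≤ M ∨ h ^ θ = 0 := by
        rcases (Real.rpow_nonneg hh0 θ).eq_or_lt with h0 | h0
        · exact Or.inr h0.symm
        · exact Or.inl (nonneg_of_mul_nonneg_left hM h0)
      rcases hM' with hM0 | hz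
      · have hK : 0 ≤ 2 * M / (1 - 2 ^ (1 - θ)) := div_nonneg (by linarith) (by linarith)
        set K := 2 * M / (1 - 2 ^ (1 - θ)) with hKdef
        have hK' : K * 2 ^ (1 - θ) + 2 * M = K := by
          rw [hKdef]; field_simp [show (1 : ℝ) - 2 ^ (1 - θ) ≠ 0 by linarith]; ring
        have e1 : K * (v m - v a) ^ θ ≤ K * (h / 2) ^ θ :=
          mul_le_mul_of_nonneg_left (Real.rpow_le_rpow (by linarith [hv h1]) (by linarith)
            (by linarith)) hK
        have e2 : K * (v (a + n) - v (m + 1)) ^ θ ≤ K * (h / 2) ^ θ :=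
          mul_le_mul_of_nonneg_left (Real.rpow_le_rpow
            (by linarith [hv (show m + 1 ≤ a + n from h2)]) (by linarith) (by linarith)) hK
        have e3 : M * (v (a + n) - v m) ^ θ ≤ M * h ^ θ :=
          mul_le_mul_of_nonneg_left (Real.rpow_le_rpow (by linarith [hv h2.le])
            (by linarith [hv h1]) (by linarith)) hM0
        calc ‖∑ i ∈ Finset.Ico a (a + n), Ξ (v i) (v (i + 1)) - Ξ (v a) (v (a + n))‖
            = ‖(S1 - Ξ (v a) (v m)) + (S2 - Ξ (v (m + 1)) (v (a + n)))
              - (Ξ (v a) (v (a + n)) - Ξ (v a) (v m) - Ξ (v m) (v (a + n)))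
              - (Ξ (v m) (v (a + n)) - Ξ (v m) (v (m + 1)) - Ξ (v (m + 1)) (v (a + n)))‖ := by
              rw [hs]; congr 1; abel
          _ ≤ K * (h / 2) ^ θ + K * (h / 2) ^ θ + M * h ^ θ + M * h ^ θ := by
              refine (norm_sub_le _ _).trans (add_le_add ((norm_sub_le _ _).trans
                (add_le_add ((norm_add_le _ _).trans (add_le_add ?_ ?_)) ?_)) ?_)
              · exact i1.trans e1
              · exact i2.trans e2
              · exact d1
              · exact d2.trans e3
          _ = (K * 2 ^ (1 - θ) + 2 * M) * h ^ θ := by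
              have := two_mul_half_rpow (θ := θ) hh0
              linear_combination K * this
          _ = K * h ^ θ := by rw [hK']
      · have hh1 : h = 0 := by
          by_contra hne
          exact (Real.rpow_pos_of_pos (lt_of_le_of_ne hh0 (Ne.symm hne)) θ).ne' hz
        have q1 : v m = v a := le_antisymm (by linarith) (hv h1)
        have q2 : v (m + 1) = v a := le_antisymm (by linarith [hv (show m + 1 ≤ a + n from h2)])
          (by linarith [hv (show a ≤ m + 1 by omega)])
        have q3 : v (a + n) = v a := by linarith
        have z0 : (0 : ℝ) ^ θ = 0 := Real.zero_rpow (by linarith)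
        rw [hz, mul_zero, hs]
        simp only [q1, q2, q3, hz, sub_self, z0, mul_zero] at i1 i2 d1 ⊢
        have z1 : S1 - Ξ (v a) (v a) = 0 := norm_le_zero_iff.mp i1
        have z2 : S2 - Ξ (v a) (v a) = 0 := norm_le_zero_iff.mp i2
        have z3 : Ξ (v a) (v a) = 0 := by simpa using d1
        rw [z3, sub_zero] at z1 z2
        simp [z1, z2, z3]

theorem exists_monotone_enum {F : Finset ℝ} (hF : ∀ x ∈ F, x ∈ Icc 0 T) (hne : F.Nonempty) :
    ∃ v : ℕ → ℝ, Monotone v ∧ (∀ i, v i ∈ Icc 0 T) ∧ ∀ x ∈ F, ∃ i, v i = x := by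
  have hc : 0 < F.card := hne.card_pos
  refine ⟨fun i => F.orderEmbOfFin rfl ⟨min i (F.card - 1), by omega⟩, ?_, ?_, ?_⟩
  · intro i j hij
    refine (F.orderEmbOfFin rfl).monotone ?_
    simp only [Fin.mk_le_mk]
    omega
  · exact fun i => hF _ (F.orderEmbOfFin_mem rfl _)
  · intro x hx
    have : x ∈ Set.range (F.orderEmbOfFin rfl) := by
      rw [Finset.range_orderEmbOfFin]; exact hx
    obtain ⟨i, rfl⟩ := this
    have hi : (⟨min (i : ℕ) (F.card - 1), by omega⟩ : Fin F.card) = i :=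
      Fin.ext (by simp only; omega)
    exact ⟨i, congrArg (F.orderEmbOfFin rfl) hi⟩

/-- The additive sewing lemma on finitely many points. -/
theorem sewing_finite (hθ : 1 < θ)
    (hΞ : ∀ s u t, 0 ≤ s → s ≤ u → u ≤ t → t ≤ T → ‖Ξ s t - Ξ s u - Ξ u t‖ ≤ M * (t - s) ^ θ)
    {F : Finset ℝ} (hF : ∀ x ∈ F, x ∈ Icc 0 T) (h0 : 0 ∈ F) :
    ∃ φ : ℝ → E, φ 0 = 0 ∧ ∀ s ∈ F, ∀ t ∈ F, s ≤ t →
      ‖Ξ s t - (φ t - φ s)‖ ≤ 2 * M / (1 - 2 ^ (1 - θ)) * (t - s) ^ θ := by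
  obtain ⟨v, hv, hv', hvF⟩ := exists_monotone_enum hF ⟨0, h0⟩
  choose! idx hidx using hvF
  -- Partial sums along the enumeration, normalised to vanish at 0; the normalisation bounds φ
  -- pointwise, independently of F.
  refine ⟨fun x => ∑ i ∈ Finset.range (idx x), Ξ (v i) (v (i + 1)) -
    ∑ i ∈ Finset.range (idx 0), Ξ (v i) (v (i + 1)), sub_self _, fun s hs t ht hst => ?_⟩
  have hle : idx s ≤ idx t := by
    by_contra hlt
    have := hv (not_le.mp hlt).le
    rw [hidx s hs, hidx t ht] at this
    rw [le_antisymm hst this] at hlt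
    exact hlt le_rfl
  have := sewing_sum_le hθ hΞ hv hv' (idx t - idx s) (idx s) (idx t) (by omega)
  rw [Finset.sum_Ico_eq_sub _ hle, hidx s hs, hidx t ht, norm_sub_rev] at this
  simpa using this

/-- The additive sewing lemma. -/
theorem sewing [NormedSpace ℝ E] [FiniteDimensional ℝ E] (hθ : 1 < θ) (hT : 0 ≤ T)
    (hΞ : ∀ s u t, 0 ≤ s → s ≤ u → u ≤ t → t ≤ T → ‖Ξ s t - Ξ s u - Ξ u t‖ ≤ M * (t - s) ^ θ) :
    ∃ φ : ℝ → E, ∀ s t, 0 ≤ s → s ≤ t → t ≤ T →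
      ‖Ξ s t - (φ t - φ s)‖ ≤ 2 * M / (1 - 2 ^ (1 - θ)) * (t - s) ^ θ := by
  classical
  have : ProperSpace E := FiniteDimensional.proper_real E
  set K := 2 * M / (1 - 2 ^ (1 - θ)) with hK
  -- The radii come from the sewing estimate with s = 0, so every finite-set solution, extended by
  -- zero, lies in this box, compact by Tychonoff. Each pair of times imposes a closed condition on
  -- φ.
  set B : Set (Icc (0 : ℝ) T → E) :=
    Set.pi univ fun t => Metric.closedBall 0 (‖Ξ 0 t‖ + |K * (t : ℝ) ^ θ|) with hB
  have hBc : IsCompact B := isCompact_univ_pi fun t => isCompact_closedBall _ _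
  set A : Icc (0 : ℝ) T × Icc (0 : ℝ) T → Set (Icc (0 : ℝ) T → E) := fun p =>
    {φ | p.1 ≤ p.2 → ‖Ξ p.1 p.2 - (φ p.2 - φ p.1)‖ ≤ K * ((p.2 : ℝ) - p.1) ^ θ} with hA
  have hAc : ∀ p, IsClosed (A p) := by
    intro p
    by_cases hp : p.1 ≤ p.2
    · simp only [hA, hp, forall_const]
      exact isClosed_le (by fun_prop) continuous_const
    · simp [hA, hp]
  obtain ⟨φ, -, hφ⟩ := hBc.inter_iInter_nonempty A hAc fun u => by
    set F : Finset ℝ := insert 0 (u.image (fun p => (p.1 : ℝ)) ∪ u.image (fun p => (p.2 : ℝ)))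
      with hFdef
    have hF : ∀ x ∈ F, x ∈ Icc 0 T := by
      intro x hx
      simp only [hFdef, Finset.mem_insert, Finset.mem_union, Finset.mem_image] at hx
      rcases hx with rfl | ⟨p, -, rfl⟩ | ⟨p, -, rfl⟩
      · exact ⟨le_rfl, hT⟩
      · exact p.1.2
      · exact p.2.2
    obtain ⟨φ, hφ0, hφ⟩ := sewing_finite hθ hΞ hF (Finset.mem_insert_self _ _)
    refine ⟨fun t => if (t : ℝ) ∈ F then φ t else 0, ?_, ?_⟩
    · simp only [hB, Set.mem_pi, mem_univ, forall_const, mem_closedBall_zero_iff]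
      intro t
      split_ifs with ht
      · have h := hφ 0 (Finset.mem_insert_self _ _) t ht t.2.1
        rw [hφ0, sub_zero, sub_zero] at h
        have h2 := norm_sub_norm_le (φ t) (Ξ 0 t)
        rw [norm_sub_rev] at h2
        linarith [le_abs_self (K * (t : ℝ) ^ θ)]
      · rw [norm_zero]; positivity
    · simp only [mem_iInter, hA, mem_ofPred_eq]
      intro p hp hle
      have m1 : (p.1 : ℝ) ∈ F := by
        simp only [hFdef, Finset.mem_insert, Finset.mem_union, Finset.mem_image]
        exact Or.inr (Or.inl ⟨p, hp, rfl⟩)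
      have m2 : (p.2 : ℝ) ∈ F := by
        simp only [hFdef, Finset.mem_insert, Finset.mem_union, Finset.mem_image]
        exact Or.inr (Or.inr ⟨p, hp, rfl⟩)
      rw [if_pos m1, if_pos m2]
      exact hφ _ m1 _ m2 hle
  refine ⟨fun t => φ (projIcc 0 T hT t), fun s t hs hst ht => ?_⟩
  have hs' : s ∈ Icc 0 T := ⟨hs, hst.trans ht⟩
  have ht' : t ∈ Icc 0 T := ⟨hs.trans hst, ht⟩
  simp only [projIcc_of_mem hT hs', projIcc_of_mem hT ht']
  exact mem_iInter.mp hφ (⟨s, hs'⟩, ⟨t, ht'⟩) hst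

end Sewing

/-! ### Bisection, and the vanishing of small additive functions. -/

/-- A bound through repeated bisection of the interval. -/
theorem le_of_bisection {f : ℝ → ℝ → ℝ} {a M θ T : ℝ} (hθ : 1 < θ)
    (hM : ∀ s t, 0 ≤ s → s ≤ t → t ≤ T → f s t ≤ M * (t - s) ^ θ)
    (hf : ∀ s t, 0 ≤ s → s ≤ t → t ≤ T →
      f s t ≤ a * (t - s) ^ θ + f s ((s + t) / 2) + f ((s + t) / 2) t)
    {s t : ℝ} (hs : 0 ≤ s) (hst : s ≤ t) (ht : t ≤ T) (ha : 0 ≤ a) :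
    f s t ≤ a / (1 - 2 ^ (1 - θ)) * (t - s) ^ θ := by
  have hr := two_rpow_one_sub_lt_one hθ
  have hr0 : (0 : ℝ) < 2 ^ (1 - θ) := by positivity
  set r : ℝ := 2 ^ (1 - θ) with hrdef
  set B := a / (1 - r) with hB
  have hB' : a + r * B = B := by
    rw [hB]; field_simp [show (1 : ℝ) - r ≠ 0 by linarith]; ring
  -- B is the fixed point of x ↦ a + r x; the a priori constant M survives only with the factor r ^
  -- n.
  have key : ∀ n : ℕ, ∀ s t, 0 ≤ s → s ≤ t → t ≤ T →
      f s t ≤ (B + M * r ^ n) * (t - s) ^ θ := by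
    intro n
    induction n with
    | zero =>
      intro s t hs hst ht
      refine (hM s t hs hst ht).trans ?_
      have hB0 : 0 ≤ B := div_nonneg ha (by linarith)
      have := Real.rpow_nonneg (sub_nonneg.mpr hst) θ
      nlinarith
    | succ n ih =>
      intro s t hs hst ht
      have h1 := ih s ((s + t) / 2) hs (by linarith) (by linarith)
      have h2 := ih ((s + t) / 2) t (by linarith) (by linarith) ht
      have h3 := hf s t hs hst ht
      have e1 : (s + t) / 2 - s = (t - s) / 2 := by ring
      have e2 : t - (s + t) / 2 = (t - s) / 2 := by ring
      rw [e1] at h1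
      rw [e2] at h2
      have h4 := two_mul_half_rpow (θ := θ) (sub_nonneg.mpr hst)
      rw [← hrdef] at h4
      calc f s t ≤ a * (t - s) ^ θ + (B + M * r ^ n) * (2 * ((t - s) / 2) ^ θ) := by linarith
        _ = (a + r * B + M * r ^ (n + 1)) * (t - s) ^ θ := by rw [h4]; ring
        _ = _ := by rw [hB']
  have hlim : Tendsto (fun n : ℕ => (B + M * r ^ n) * (t - s) ^ θ) atTop
      (𝓝 ((B + M * 0) * (t - s) ^ θ)) :=
    ((tendsto_const_nhds).add 
      ((tendsto_pow_atTop_nhds_zero_of_lt_one hr0.le hr).const_mul M)).mul_const _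
  rw [mul_zero, add_zero] at hlim
  exact ge_of_tendsto' hlim fun n => key n s t hs hst ht

/-- An additive function of intervals bounded by a power greater than one of a control vanishes. -/
theorem additive_eq_zero {E : Type*} [AddCommGroup E] [Module ℝ E] (p : Seminorm ℝ E)
    {Z : ℝ → ℝ → E} {ω : ℝ → ℝ → ℝ} {θ T c : ℝ} (hθ : 1 < θ) (hω : IsControl T ω)
    (hZ : ∀ s u t, 0 ≤ s → s ≤ u → u ≤ t → t ≤ T → Z s t = Z s u + Z u t)
    (hb : ∀ s t, 0 ≤ s → s ≤ t → t ≤ T → p (Z s t) ≤ c * ω s t ^ θ) (hc : 0 ≤ c)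
    {s t : ℝ} (hs : 0 ≤ s) (hst : s ≤ t) (ht : t ≤ T) : p (Z s t) = 0 := by
  set D : Set (ℝ × ℝ) := {q | 0 ≤ q.1 ∧ q.1 ≤ q.2 ∧ q.2 ≤ T} with hD
  have hDc : IsCompact D := by
    refine (isCompact_Icc.prod isCompact_Icc :
      IsCompact (Icc (0 : ℝ) T ×ˢ Icc (0 : ℝ) T)).of_isClosed_subset ?_ ?_
    · exact (isClosed_le continuous_const continuous_fst).inter
        ((isClosed_le continuous_fst continuous_snd).inter
          (isClosed_le continuous_snd continuous_const))
    · rintro ⟨a, b⟩ ⟨h1, h2, h3⟩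
      exact ⟨⟨h1, h2.trans h3⟩, ⟨h1.trans h2, h3⟩⟩
  have huc := hDc.uniformContinuousOn_of_continuous hω.continuousOn
  rw [Metric.uniformContinuousOn_iff] at huc
  have hωn := hω.nonneg s t hs hst ht
  -- On a mesh so fine that ω < ε on each piece, ω ^ θ ≤ ε ^ (θ - 1) * ω, and superadditivity sums
  -- the pieces.
  have key : ∀ ε > 0, p (Z s t) ≤ c * (ε ^ (θ - 1) * ω s t) := by
    intro ε hε
    obtain ⟨δ, hδ, hδ'⟩ := huc ε hε
    obtain ⟨n, hn⟩ := exists_nat_gt ((t - s) / δ)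
    have hn0 : (0 : ℝ) < n := (div_nonneg (by linarith) hδ.le).trans_lt hn
    have hmesh : (t - s) / n < δ := by
      rw [div_lt_iff₀ hn0]; rw [div_lt_iff₀ hδ] at hn; linarith
    have hh : 0 ≤ (t - s) / n := div_nonneg (by linarith) hn0.le
    set h := (t - s) / n with hhdef
    have hnt : s + n * h = t := by rw [hhdef]; field_simp; ring
    have step : ∀ m : ℕ, m ≤ n → p (Z s (s + m * h)) ≤ c * (ε ^ (θ - 1) * ω s (s + m * h)) := by
      intro m
      induction m with
      | zero =>
        intro _
        have h0 := hb s s hs le_rfl (hst.trans ht)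
        rw [hω.diag s hs (hst.trans ht), Real.zero_rpow (by linarith)] at h0
        simpa [hω.diag s hs (hst.trans ht)] using h0
      | succ m ih =>
        intro hm
        have hmn : ((m + 1 : ℕ) : ℝ) ≤ n := by exact_mod_cast hm
        have hle : s + ((m + 1 : ℕ) : ℝ) * h ≤ t := by nlinarith
        have he : s + ((m + 1 : ℕ) : ℝ) * h = (s + m * h) + h := by push_cast; ring
        have hmh : 0 ≤ (m : ℝ) * h := by positivity
        rw [he] at hle ⊢
        rw [hZ s (s + m * h) (s + m * h + h) hs (by linarith) (by linarith) (by linarith)]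
        have b1 := ih (by omega)
        have b2 := hb (s + m * h) (s + m * h + h) (by linarith) (by linarith) (by linarith)
        have w1 := hω.nonneg (s + m * h) (s + m * h + h) (by linarith) (by linarith) (by linarith)
        have w2 : ω (s + m * h) (s + m * h + h) < ε := by
          have := hδ' (s + m * h, s + m * h + h) ⟨by simp only; linarith, by simp only; linarith,
            by simp only; linarith⟩ (s + m * h, s + m * h) ⟨by simp only; linarith, le_rfl,
            by simp only; linarith⟩ (by
              rw [Prod.dist_eq, dist_self, Real.dist_eq]
              simp only [add_sub_cancel_left]
              rw [abs_of_nonneg hh]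
              exact max_lt hδ hmesh)
          simp only at this
          rw [hω.diag _ (by linarith) (by linarith), Real.dist_eq, sub_zero, abs_of_nonneg w1]
            at this
          exact this
        have w3 : ω (s + m * h) (s + m * h + h) ^ θ ≤
            ε ^ (θ - 1) * ω (s + m * h) (s + m * h + h) := by
          rcases w1.eq_or_lt with h0 | h0
          · rw [← h0, Real.zero_rpow (by linarith), mul_zero]
          · calc ω (s + m * h) (s + m * h + h) ^ θ
                = ω (s + m * h) (s + m * h + h) ^ (θ - 1) * ω (s + m * h) (s + m * h + h) := by
                  rw [← Real.rpow_add_one h0.ne']; congr 1; ring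
              _ ≤ _ := mul_le_mul_of_nonneg_right
                  (Real.rpow_le_rpow w1 w2.le (by linarith)) w1
        have w4 := hω.superadditive s (s + m * h) (s + m * h + h) hs (by linarith) (by linarith)
          (by linarith)
        have w5 : 0 ≤ ε ^ (θ - 1) := by positivity
        calc p (Z s (s + m * h) + Z (s + m * h) (s + m * h + h))
            ≤ c * (ε ^ (θ - 1) * ω s (s + m * h)) +
              c * (ε ^ (θ - 1) * ω (s + m * h) (s + m * h + h)) :=
              (map_add_le_add p _ _).trans
                (add_le_add b1 (b2.trans (mul_le_mul_of_nonneg_left w3 hc)))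
          _ = c * (ε ^ (θ - 1) * (ω s (s + m * h) + ω (s + m * h) (s + m * h + h))) := by ring
          _ ≤ _ := mul_le_mul_of_nonneg_left (mul_le_mul_of_nonneg_left w4 w5) hc
    have := step n le_rfl
    rwa [hnt] at this
  have hlim : Tendsto (fun ε : ℝ => c * (ε ^ (θ - 1) * ω s t)) (𝓝[>] 0)
      (𝓝 (c * ((0 : ℝ) ^ (θ - 1) * ω s t))) := by
    refine (((Real.continuousAt_rpow_const 0 (θ - 1) (Or.inr (by linarith))).tendsto.mono_left
      nhdsWithin_le_nhds).mul_const _).const_mul _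
  rw [Real.zero_rpow (by linarith), zero_mul, mul_zero] at hlim
  exact le_antisymm (ge_of_tendsto hlim (eventually_nhdsWithin_of_forall key)) (apply_nonneg p _)

/-! ### Equivalence of norms on a tensor power. -/

theorem seminorm_le_norm {d k : ℕ} (p : Seminorm ℝ (Tensor d k)) :
    ∃ c, 0 ≤ c ∧ ∀ ξ, p ξ ≤ c * ‖ξ‖ := by
  classical
  refine ⟨∑ w, p (Pi.single w 1), Finset.sum_nonneg fun _ _ => apply_nonneg p _, fun ξ => ?_⟩
  have h : ξ = ∑ w, ξ w • (Pi.single w 1 : Tensor d k) := by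
    ext w
    simp [Finset.sum_apply, Pi.single_apply]
  conv_lhs => rw [h]
  refine (Finset.le_sum_of_subadditive p (map_zero _).le (map_add_le_add _) _ _).trans ?_
  rw [Finset.sum_mul]
  refine Finset.sum_le_sum fun w _ => ?_
  rw [map_smul_eq_mul, mul_comm]
  exact mul_le_mul_of_nonneg_left (norm_le_pi_norm ξ w) (apply_nonneg p _)

theorem norm_le_seminorm {d k : ℕ} (p : Seminorm ℝ (Tensor d k)) (hp : ∀ ξ, p ξ = 0 → ξ = 0) :
    ∃ c, 0 ≤ c ∧ ∀ ξ, ‖ξ‖ ≤ c * p ξ := by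
  obtain ⟨c, hc, hle⟩ := seminorm_le_norm p
  have hcont : Continuous p := by
    have : LipschitzWith ⟨c, hc⟩ p := LipschitzWith.of_dist_le_mul fun x y => by
      rw [Real.dist_eq, dist_eq_norm]
      exact (abs_sub_map_le_sub p x y).trans (hle _)
    exact this.continuous
  -- The unit sphere is empty when the tensor space is zero.
  rcases (Metric.sphere (0 : Tensor d k) 1).eq_empty_or_nonempty with he | hne
  · refine ⟨0, le_rfl, fun ξ => ?_⟩
    by_contra hξ
    have h0 : ‖ξ‖ ≠ 0 := by intro h; rw [h] at hξ; simp at hξ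
    have : (‖ξ‖⁻¹ • ξ) ∈ Metric.sphere (0 : Tensor d k) 1 := by
      rw [mem_sphere_zero_iff_norm, norm_smul, norm_inv, norm_norm, inv_mul_cancel₀ h0]
    rw [he] at this
    exact this
  · obtain ⟨x, hx, hmin⟩ := (isCompact_sphere (0 : Tensor d k) 1).exists_isMinOn hne
      hcont.continuousOn
    have hpx : 0 < p x := lt_of_le_of_ne (apply_nonneg p _) fun h => by
      rw [hp x h.symm] at hx
      simp at hx
    refine ⟨(p x)⁻¹, by positivity, fun ξ => ?_⟩
    rcases eq_or_ne ξ 0 with rfl | hξ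
    · simp
    have h0 : ‖ξ‖ ≠ 0 := norm_ne_zero_iff.mpr hξ
    have hm : p x ≤ p (‖ξ‖⁻¹ • ξ) := hmin (by
      rw [mem_sphere_zero_iff_norm, norm_smul, norm_inv, norm_norm, inv_mul_cancel₀ h0])
    rw [map_smul_eq_mul, norm_inv, norm_norm, ← div_eq_inv_mul,
      le_div_iff₀ (norm_pos_iff.mpr hξ)] at hm
    rw [← div_eq_inv_mul, le_div_iff₀ hpx]
    linarith

/-! ### Elementary bounds for the Gamma function. -/

theorem one_le_Gamma {x : ℝ} (hx : 0 < x) (hx1 : x ≤ 1) : 1 ≤ Real.Gamma x := by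
  have := Real.Gamma_strictAntiOn_Ioc.antitoneOn ⟨hx, hx1⟩ ⟨one_pos, le_rfl⟩ hx1
  rwa [Real.Gamma_one] at this

theorem Gamma_le_one {x : ℝ} (hx : 1 ≤ x) (hx2 : x ≤ 2) : Real.Gamma x ≤ 1 := by
  have h := Real.convexOn_Gamma.2 (show (1 : ℝ) ∈ Ioi 0 by simp) (show (2 : ℝ) ∈ Ioi 0 by simp)
    (show 0 ≤ 2 - x by linarith) (show 0 ≤ x - 1 by linarith) (by ring)
  simp only [smul_eq_mul, Real.Gamma_one, Real.Gamma_two] at h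
  rw [show (2 - x) * 1 + (x - 1) * 2 = x by ring] at h
  linarith

/-- The functional equation carries the bound upwards from [1, 2], where Γ ≤ 1 by convexity. -/
theorem Gamma_le_rpow {x : ℝ} (hx : 1 ≤ x) : Real.Gamma x ≤ x ^ (x - 1) := by
  have key : ∀ n : ℕ, ∀ x : ℝ, 1 ≤ x → x ≤ n + 2 → Real.Gamma x ≤ x ^ (x - 1) := by
    intro n
    induction n with
    | zero =>
      intro x h1 h2
      refine (Gamma_le_one h1 (by simpa using h2)).trans (Real.one_le_rpow h1 (by linarith))
    | succ n ih =>
      intro x h1 h2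
      push_cast at h2
      rcases le_or_gt x 2 with h | h
      · exact (Gamma_le_one h1 h).trans (Real.one_le_rpow h1 (by linarith))
      · have h3 := ih (x - 1) (by linarith) (by linarith)
        have h4 := Real.Gamma_add_one (s := x - 1) (by linarith)
        rw [sub_add_cancel] at h4
        have h5 : (x - 1) * (x - 1) ^ (x - 1 - 1) = (x - 1) ^ (x - 1) := by
          rw [mul_comm, ← Real.rpow_add_one (by linarith)]; congr 1; ring
        calc Real.Gamma x ≤ (x - 1) * (x - 1) ^ (x - 1 - 1) := by
              rw [h4]; exact mul_le_mul_of_nonneg_left h3 (by linarith)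
          _ = (x - 1) ^ (x - 1) := h5
          _ ≤ x ^ (x - 1) := Real.rpow_le_rpow (by linarith) (by linarith) (by linarith)
  obtain ⟨n, hn⟩ := exists_nat_ge x
  exact key n x hx (by linarith)

theorem four_mul_Gamma_le {x : ℝ} (hx : 1 ≤ x) : 4 * Real.Gamma x ≤ (x + 1) ^ (x + 1) := by
  have h1 : (x + 1) ^ (x + 1) = (x + 1) ^ (x - 1) * (x + 1) ^ 2 := by
    rw [← Real.rpow_natCast (x + 1) 2, ← Real.rpow_add (by linarith)]
    congr 1; push_cast; ring
  have h2 : x ^ (x - 1) ≤ (x + 1) ^ (x - 1) :=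
    Real.rpow_le_rpow (by linarith) (by linarith) (by linarith)
  have h3 := Gamma_le_rpow hx
  have h4 : 0 < Real.Gamma x := Real.Gamma_pos_of_pos (by linarith)
  have h5 : (x + 1) ^ (x - 1) * 4 ≤ (x + 1) ^ (x - 1) * (x + 1) ^ 2 :=
    mul_le_mul_of_nonneg_left (by nlinarith) (Real.rpow_nonneg (by linarith) _)
  linarith

/-! ### Lower bounds for the constant α. -/

/-- Comparison of the terms of `∑ n^{-(1+u)}` with a telescoping series. -/
theorem telescoping_le {u n : ℝ} (hu : 0 < u) (hu1 : u ≤ 1) (hn : 0 < n) :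
    n ^ (-u) - (n + 1) ^ (-u) ≤ u * n ^ (-(1 + u)) := by
  have h1 : (1 + 1 / n) ^ u ≤ 1 + u * (1 / n) :=
    rpow_one_add_le_one_add_mul_self (by have : 0 < 1 / n := by positivity
                                         linarith) hu.le hu1
  have h2 : (n + 1) = n * (1 + 1 / n) := by field_simp
  have h3 : n ^ (-(1 + u)) = n ^ (-u) * (1 / n) := by
    rw [show -(1 + u) = -u - 1 by ring, Real.rpow_sub_one hn.ne']; ring
  have h4 : 0 < n ^ (-u) := by positivity
  have h5 : 1 - u * (1 / n) ≤ (1 + 1 / n) ^ (-u) := by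
    rw [Real.rpow_neg (by positivity)]
    have h6 : 0 < (1 + 1 / n) ^ u := by positivity
    have h7 : (1 + u * (1 / n))⁻¹ ≤ ((1 + 1 / n) ^ u)⁻¹ := inv_anti₀ h6 h1
    refine le_trans ?_ h7
    have h8 : 0 < 1 + u * (1 / n) := by positivity
    rw [← one_div, le_div_iff₀ h8]
    nlinarith [sq_nonneg (u * (1 / n))]
  rw [h2, Real.mul_rpow hn.le (by positivity), h3]
  nlinarith

theorem summable_alpha {β : ℝ} (hβ : 1 / 3 < β) :
    Summable fun q : ℕ => (2 / ((q : ℝ) + 1)) ^ (3 * β) := by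
  have h := (summable_nat_add_iff 1).mpr
    (Real.summable_nat_rpow_inv.mpr (show 1 < 3 * β by linarith))
  refine (h.mul_left (2 ^ (3 * β))).congr fun q => ?_
  rw [Real.div_rpow (by norm_num) (by positivity)]
  push_cast
  rfl

/-- With u = 3β - 1, telescoping bounds ∑ n^{-(1+u)} below by 1/u, and the factor 2^{3β} is at least
2. -/
theorem le_tsum_alpha {β : ℝ} (hβ : 1 / 3 < β) (hβ' : β < 1 / 2) :
    2 / (3 * β - 1) ≤ ∑' q : ℕ, (2 / ((q : ℝ) + 1)) ^ (3 * β) := by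
  set u := 3 * β - 1 with hu
  have hu0 : 0 < u := by linarith
  have hterm : ∀ q : ℕ, 2 / u * (((q : ℝ) + 1) ^ (-u) - (((q + 1 : ℕ) : ℝ) + 1) ^ (-u)) ≤
      (2 / ((q : ℝ) + 1)) ^ (3 * β) := by
    intro q
    have h1 := telescoping_le hu0 (by linarith) (show (0 : ℝ) < (q : ℝ) + 1 by positivity)
    have h2 : (2 : ℝ) ≤ 2 ^ (3 * β) := by
      conv_lhs => rw [← Real.rpow_one 2]
      exact Real.rpow_le_rpow_of_exponent_le (by norm_num) (by linarith)
    have h3 : (0 : ℝ) < ((q : ℝ) + 1) ^ (-(1 + u)) := by positivity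
    rw [Real.div_rpow (by norm_num) (by positivity), div_eq_mul_inv _ (((q : ℝ) + 1) ^ (3 * β)),
      ← Real.rpow_neg (by positivity), show -(3 * β) = -(1 + u) by rw [hu]; ring]
    calc _ ≤ 2 / u * (u * ((q : ℝ) + 1) ^ (-(1 + u))) := by
          push_cast
          exact mul_le_mul_of_nonneg_left h1 (by positivity)
      _ = 2 * ((q : ℝ) + 1) ^ (-(1 + u)) := by field_simp
      _ ≤ _ := mul_le_mul_of_nonneg_right h2 h3.le
  have hpart : ∀ n : ℕ, 2 / u * (1 - ((n : ℝ) + 1) ^ (-u)) ≤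
      ∑' q : ℕ, (2 / ((q : ℝ) + 1)) ^ (3 * β) := by
    intro n
    refine le_trans ?_ ((summable_alpha hβ).sum_le_tsum (Finset.range n)
      (fun q _ => by positivity))
    refine le_trans (le_of_eq ?_) (Finset.sum_le_sum fun q _ => hterm q)
    rw [← Finset.mul_sum, Finset.sum_range_sub']
    simp
  have hlim : Tendsto (fun n : ℕ => 2 / u * (1 - ((n : ℝ) + 1) ^ (-u))) atTop
      (𝓝 (2 / u * (1 - 0))) := by
    refine (tendsto_const_nhds.sub ?_).const_mul _
    exact (tendsto_rpow_neg_atTop hu0).comp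
      (tendsto_atTop_add_const_right _ _ tendsto_natCast_atTop_atTop)
  rw [sub_zero, mul_one] at hlim
  exact le_of_tendsto' hlim hpart

theorem alphaConst_pos {β : ℝ} (hβ : 1 / 3 < β) : 0 < alphaConst β := by
  have h : 0 ≤ ∑' q : ℕ, (2 / ((q : ℝ) + 1)) ^ (3 * β) := tsum_nonneg fun q => by positivity
  have : 0 < β := by linarith
  unfold alphaConst
  positivity

/-- For v ≤ 1, Bernoulli's inequality gives 1 - 2^{-v} ≥ v/2, which offsets 2/u ≥ 2/v. For larger v,
the bound 1 + 2/u ≥ 5 is enough, with a separate estimate beyond v = 3. -/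
theorem one_sub_two_rpow_bound {u v : ℝ} (hu : 0 < u) (hu1 : u ≤ 1 / 2) (huv : u ≤ v) :
    4 * (v + 1 / 2) / (v + 3) ≤ (1 + 2 / u) * (1 - 2 ^ (-v)) := by
  have hv : 0 < v := hu.trans_le huv
  have h5 : 5 ≤ 1 + 2 / u := by
    have : 4 ≤ 2 / u := by rw [le_div_iff₀ hu]; linarith
    linarith
  rcases le_or_gt v 1 with h1 | h1
  · have h2 : v / 2 ≤ 1 - 2 ^ (-v) := by
      have h := rpow_one_add_le_one_add_mul_self (s := -1 / 2) (by norm_num) hv.le h1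
      have e : (2 : ℝ) ^ (-v) = (1 + -1 / 2) ^ v := by
        rw [Real.rpow_neg (by norm_num), ← Real.inv_rpow (by norm_num)]; norm_num
      rw [e]
      linarith
    have h3 : 1 + 2 / v ≤ 1 + 2 / u := by
      have := div_le_div_of_nonneg_left (show (0 : ℝ) ≤ 2 by norm_num) hu huv
      linarith
    have h4 : (1 + 2 / v) * (v / 2) ≤ (1 + 2 / u) * (1 - 2 ^ (-v)) :=
      mul_le_mul h3 h2 (by positivity) (by linarith)
    refine le_trans ?_ h4
    have e : (1 + 2 / v) * (v / 2) = v / 2 + 1 := by field_simp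
    rw [e, div_le_iff₀ (by linarith)]
    nlinarith
  · rcases le_or_gt v 3 with h3 | h3
    · have h2 : (2 : ℝ) ^ (-v) ≤ 1 / 2 := by
        have := Real.rpow_le_rpow_of_exponent_le (show (1 : ℝ) ≤ 2 by norm_num)
          (show -v ≤ -1 by linarith)
        rw [Real.rpow_neg_one] at this
        linarith
      have h6 : 4 * (v + 1 / 2) / (v + 3) ≤ 5 / 2 := by
        rw [div_le_iff₀ (by linarith)]; linarith
      nlinarith
    · have h2 : (2 : ℝ) ^ (-v) ≤ 1 / 8 := by
        have := Real.rpow_le_rpow_of_exponent_le (show (1 : ℝ) ≤ 2 by norm_num)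
          (show -v ≤ -3 by linarith)
        rw [Real.rpow_neg (by norm_num) 3] at this
        norm_num at this
        linarith
      have h6 : 4 * (v + 1 / 2) / (v + 3) ≤ 4 := by
        rw [div_le_iff₀ (by linarith)]; linarith
      nlinarith

theorem alpha_inequality {β : ℝ} (hβ : 1 / 3 < β) (hβ' : β < 1 / 2) {k : ℕ} (hk : 3 ≤ k) :
    8 * ((k : ℝ) - 1) / (k * β + 2) ≤ alphaConst β * (1 - 2 ^ (1 - k * β)) := by
  have hk' : (3 : ℝ) ≤ k := by exact_mod_cast hk
  have hβ0 : 0 < β := by linarith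
  have hx : 3 * β ≤ k * β := mul_le_mul_of_nonneg_right hk' hβ0.le
  set x := (k : ℝ) * β with hxdef
  have h1 := one_sub_two_rpow_bound (u := 3 * β - 1) (v := x - 1) (by linarith) (by linarith)
    (by linarith)
  rw [show -(x - 1) = 1 - x by ring, show x - 1 + 1 / 2 = x - 1 / 2 by ring,
    show x - 1 + 3 = x + 2 by ring] at h1
  have h2 := le_tsum_alpha hβ hβ'
  have h3 : (2 : ℝ) ^ (1 - x) < 1 := two_rpow_one_sub_lt_one (by linarith)
  have h4 : 8 * ((k : ℝ) - 1) / (x + 2) ≤ 1 / β ^ 2 * (4 * (x - 1 / 2) / (x + 2)) := by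
    have e : 8 * ((k : ℝ) - 1) / (x + 2) = 1 / β ^ 2 * (8 * β * (x - β) / (x + 2)) := by
      rw [hxdef]; field_simp
    rw [e]
    refine mul_le_mul_of_nonneg_left ?_ (by positivity)
    refine div_le_div_of_nonneg_right ?_ (by linarith)
    nlinarith [mul_nonneg (show 0 ≤ 1 / 2 - β by linarith) (show 0 ≤ x - 1 / 2 - β by linarith)]
  refine h4.trans ?_
  unfold alphaConst
  rw [mul_assoc]
  refine mul_le_mul_of_nonneg_left (h1.trans ?_) (by positivity)
  exact mul_le_mul_of_nonneg_right (by linarith) (by linarith)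

/-! ### Comparison coefficients and their convolution. -/

/-- The coefficients of the comparison series. -/
def compCoeff (β : ℝ) (k : ℕ) : ℝ := 4 * ((k : ℝ) * β + 1) ^ (-((k : ℝ) * β + 1))

theorem compCoeff_nonneg {β : ℝ} (hβ : 0 < β) (k : ℕ) : 0 ≤ compCoeff β k := by
  unfold compCoeff; positivity

/-- Midpoint convexity of x log x gives a^a b^b ≥ ((a+b)/2)^{a+b}, and a + b does not depend on j.
-/
theorem compCoeff_mul_le {β : ℝ} (hβ : 0 < β) {j k : ℕ} (hj : j ≤ k) :
    compCoeff β j * compCoeff β (k - j) ≤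
      16 * (((k : ℝ) * β + 2) / 2) ^ (-((k : ℝ) * β + 2)) := by
  have hcast : ((k - j : ℕ) : ℝ) = k - j := Nat.cast_sub hj
  unfold compCoeff
  rw [hcast]
  have hkj : (0 : ℝ) ≤ k - j := by rw [← hcast]; positivity
  set a := (j : ℝ) * β + 1 with ha
  set b := ((k : ℝ) - j) * β + 1 with hb
  have ha0 : 0 < a := by positivity
  have hb0 : 0 < b := by positivity
  have hab : (k : ℝ) * β + 2 = a + b := by rw [ha, hb]; ring
  rw [hab]
  have hc := Real.convexOn_mul_log.2 (show a ∈ Ici 0 from ha0.le) (show b ∈ Ici 0 from hb0.le)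
    (show (0 : ℝ) ≤ 1 / 2 by norm_num) (show (0 : ℝ) ≤ 1 / 2 by norm_num) (by norm_num)
  simp only [smul_eq_mul] at hc
  rw [show 1 / 2 * a + 1 / 2 * b = (a + b) / 2 by ring] at hc
  have h : a ^ (-a) * b ^ (-b) ≤ ((a + b) / 2) ^ (-(a + b)) := by
    rw [Real.rpow_def_of_pos ha0, Real.rpow_def_of_pos hb0, Real.rpow_def_of_pos (by positivity),
      ← Real.exp_add]
    refine Real.exp_le_exp.mpr ?_
    linarith
  linarith

theorem half_rpow_le {x : ℝ} (hx : 0 ≤ x) :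
    ((x + 2) / 2) ^ (-(x + 2)) ≤ 2 * 2 ^ x / (x + 2) * (x + 1) ^ (-(x + 1)) := by
  have h1 : (2 : ℝ) ≤ ((x + 2) / (x + 1)) ^ (x + 1) := by
    have := one_add_mul_self_le_rpow_one_add (s := 1 / (x + 1))
      (by have : 0 < 1 / (x + 1) := by positivity
          linarith) (p := x + 1) (by linarith)
    rw [show 1 + 1 / (x + 1) = (x + 2) / (x + 1) by field_simp; ring,
      mul_one_div_cancel (by positivity)] at this
    linarith
  rw [Real.div_rpow (by positivity) (by positivity), le_div_iff₀ (by positivity)] at h1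
  have h2 : (2 : ℝ) ^ (x + 2) = 4 * 2 ^ x := by
    rw [Real.rpow_add (by norm_num)]; norm_num; ring
  have h3 : (x + 2) ^ (x + 2) = (x + 2) ^ (x + 1) * (x + 2) := by
    rw [← Real.rpow_add_one (by positivity)]; congr 1; ring
  rw [Real.rpow_neg (by positivity), Real.div_rpow (by positivity) (by norm_num), h2, h3,
    Real.rpow_neg (by positivity), inv_div, div_mul_eq_mul_div, mul_comm _ (x + 2),
    ← div_div, div_right_comm]
  refine div_le_div_of_nonneg_right ?_ (by positivity)
  rw [← div_eq_mul_inv, div_le_div_iff₀ (by positivity) (by positivity)]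
  have : (0 : ℝ) < 2 ^ x := by positivity
  nlinarith

/-- The k - 1 products share one bound. The factor 2^{-kβ}, gained by halving intervals, cancels the
2^{kβ} of `half_rpow_le`, and `alpha_inequality` absorbs the rest. -/
theorem compCoeff_conv_le {β : ℝ} (hβ : 1 / 3 < β) (hβ' : β < 1 / 2) {k : ℕ} (hk : 3 ≤ k) :
    (∑ j ∈ Finset.Ico 1 k, compCoeff β j * compCoeff β (k - j)) * (2 ^ ((k : ℝ) * β))⁻¹ ≤
      alphaConst β * (1 - 2 ^ (1 - (k : ℝ) * β)) * compCoeff β k := by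
  have hβ0 : 0 < β := by linarith
  have h1 : ∑ j ∈ Finset.Ico 1 k, compCoeff β j * compCoeff β (k - j) ≤
      ((k : ℝ) - 1) * (16 * (((k : ℝ) * β + 2) / 2) ^ (-((k : ℝ) * β + 2))) := by
    refine (Finset.sum_le_card_nsmul _ _ _ fun j hj =>
      compCoeff_mul_le hβ0 (Finset.mem_Ico.mp hj).2.le).trans (le_of_eq ?_)
    rw [Nat.card_Ico, nsmul_eq_mul, Nat.cast_sub (by omega), Nat.cast_one]
  have h2 := half_rpow_le (x := (k : ℝ) * β) (by positivity)
  have h3 := alpha_inequality hβ hβ' hk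
  have hk1 : (0 : ℝ) ≤ (k : ℝ) - 1 := by
    have : (3 : ℝ) ≤ k := by exact_mod_cast hk
    linarith
  have h4 := compCoeff_nonneg hβ0 k
  have h5 : (0 : ℝ) < 2 ^ ((k : ℝ) * β) := by positivity
  rw [← div_eq_mul_inv, div_le_iff₀ h5]
  set x := (k : ℝ) * β with hx
  have hx0 : 0 ≤ x := by positivity
  have hc : compCoeff β k = 4 * (x + 1) ^ (-(x + 1)) := rfl
  calc _ ≤ ((k : ℝ) - 1) * (16 * (2 * 2 ^ x / (x + 2) * (x + 1) ^ (-(x + 1)))) :=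
        h1.trans (mul_le_mul_of_nonneg_left (by linarith) hk1)
    _ = (8 * ((k : ℝ) - 1) / (x + 2)) * (compCoeff β k * 2 ^ x) := by rw [hc]; ring
    _ ≤ (alphaConst β * (1 - 2 ^ (1 - x))) * (compCoeff β k * 2 ^ x) :=
        mul_le_mul_of_nonneg_right h3 (by positivity)
    _ = _ := by ring

theorem compCoeff_le_inv_Gamma {β : ℝ} {k : ℕ} (hk : 1 ≤ (k : ℝ) * β) :
    compCoeff β k ≤ (Real.Gamma (k * β))⁻¹ := by
  have h1 := four_mul_Gamma_le hk
  have h2 : 0 < Real.Gamma (k * β) := Real.Gamma_pos_of_pos (by linarith)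
  unfold compCoeff
  rw [Real.rpow_neg (by linarith), ← one_div, ← one_div, mul_one_div,
    div_le_div_iff₀ (Real.rpow_pos_of_pos (by linarith) _) h2]
  linarith

theorem inv_Gamma_le_compCoeff {β : ℝ} {k : ℕ} (hk0 : 0 < (k : ℝ) * β) (hk : (k : ℝ) * β ≤ 1) :
    (Real.Gamma (k * β))⁻¹ ≤ compCoeff β k := by
  have h1 := inv_le_one_of_one_le₀ (one_le_Gamma hk0 hk)
  refine h1.trans ?_
  unfold compCoeff
  rw [Real.rpow_neg (by linarith), ← div_eq_mul_inv,
    le_div_iff₀ (Real.rpow_pos_of_pos (by linarith) _), one_mul]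
  calc ((k : ℝ) * β + 1) ^ ((k : ℝ) * β + 1) ≤ 2 ^ ((k : ℝ) * β + 1) :=
        Real.rpow_le_rpow (by linarith) (by linarith) (by linarith)
    _ ≤ 2 ^ (2 : ℝ) := Real.rpow_le_rpow_of_exponent_le (by norm_num) (by linarith)
    _ = 4 := by norm_num

/-! ### Riemann–Stieltjes integrals. -/

theorem HasRSIntegral.sum_seq {f g : ℝ → ℝ} {a b I : ℝ} (h : HasRSIntegral f g a b I) {ε : ℝ}
    (hε : 0 < ε) : ∃ δ > 0, ∀ (n : ℕ) (v : ℕ → ℝ), Monotone v → v 0 = a → v n = b →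
      (∀ i, v (i + 1) - v i < δ) →
      |∑ i ∈ Finset.range n, f (v i) * (g (v (i + 1)) - g (v i)) - I| < ε := by
  obtain ⟨δ, hδ, h⟩ := h ε hε
  refine ⟨δ, hδ, fun n v hv h0 hn hm => ?_⟩
  have := h n (fun i => v i) (fun i => v i) (fun i j hij => hv hij) (by simpa using h0)
    (by simpa using hn) (fun i => ⟨by simpa using hm i, by simp, by simpa using hv (Nat.le_succ i)⟩)
  rw [← Fin.sum_univ_eq_sum_range (fun i => f (v i) * (g (v (i + 1)) - g (v i)))]
  simpa using this

/-- A partition of `[a, c]` through `b` with small mesh. -/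
theorem exists_fine_seq {a b c δ : ℝ} (hab : a ≤ b) (hbc : b ≤ c) (hδ : 0 < δ) :
    ∃ (n : ℕ) (v : ℕ → ℝ), Monotone v ∧ v 0 = a ∧ v n = b ∧ v (n + n) = c ∧
      ∀ i, v (i + 1) - v i < δ := by
  obtain ⟨n, hn⟩ := exists_nat_gt (max ((b - a) / δ) ((c - b) / δ))
  have h1 := (le_max_left _ _).trans_lt hn
  have h2 := (le_max_right _ _).trans_lt hn
  have hn0 : (0 : ℝ) < n := (div_nonneg (sub_nonneg.mpr hab) hδ.le).trans_lt h1
  rw [div_lt_iff₀ hδ] at h1 h2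
  have e1 : (b - a) / n < δ := by rw [div_lt_iff₀ hn0]; linarith
  have e2 : (c - b) / n < δ := by rw [div_lt_iff₀ hn0]; linarith
  have p1 : 0 ≤ (b - a) / n := div_nonneg (by linarith) hn0.le
  have p2 : 0 ≤ (c - b) / n := div_nonneg (by linarith) hn0.le
  have q1 : n * ((b - a) / n) = b - a := by field_simp
  have q2 : n * ((c - b) / n) = c - b := by field_simp
  set v : ℕ → ℝ := fun i => a + (min i n : ℕ) * ((b - a) / n) + (i - n : ℕ) * ((c - b) / n) with hv
  have hstep : ∀ i, 0 ≤ v (i + 1) - v i ∧ v (i + 1) - v i < δ := by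
    intro i
    rcases lt_or_ge i n with hi | hi
    · have : v (i + 1) - v i = (b - a) / n := by
        simp only [hv]
        rw [min_eq_left hi, min_eq_left hi.le, Nat.sub_eq_zero_of_le hi,
          Nat.sub_eq_zero_of_le hi.le]
        push_cast; ring
      rw [this]; exact ⟨p1, e1⟩
    · have : v (i + 1) - v i = (c - b) / n := by
        simp only [hv]
        rw [min_eq_right hi, min_eq_right (hi.trans (Nat.le_succ i)), Nat.succ_sub hi]
        push_cast; ring
      rw [this]; exact ⟨p2, e2⟩
  refine ⟨n, v, monotone_nat_of_le_succ fun i => by linarith [(hstep i).1], ?_, ?_, ?_,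
    fun i => (hstep i).2⟩
  · simp [hv]
  · simp [hv, q1]
  · simp [hv, q1, q2]

/-- All three integrals are known to exist, so a single fine partition through b compares them. -/
theorem HasRSIntegral.add_adjacent {f g : ℝ → ℝ} {a b c I J K : ℝ} (hab : a ≤ b) (hbc : b ≤ c)
    (hI : HasRSIntegral f g a b I) (hJ : HasRSIntegral f g b c J) (hK : HasRSIntegral f g a c K) :
    K = I + J := by
  refine eq_of_forall_dist_le fun ε hε => ?_
  obtain ⟨δ1, h1, H1⟩ := hI.sum_seq (show 0 < ε / 3 by positivity)
  obtain ⟨δ2, h2, H2⟩ := hJ.sum_seq (show 0 < ε / 3 by positivity)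
  obtain ⟨δ3, h3, H3⟩ := hK.sum_seq (show 0 < ε / 3 by positivity)
  obtain ⟨n, v, hv, v0, vn, vnn, hm⟩ :=
    exists_fine_seq hab hbc (show 0 < min δ1 (min δ2 δ3) by positivity)
  have r1 := H1 n v hv v0 vn fun i => (hm i).trans_le (min_le_left _ _)
  have r2 := H2 n (fun i => v (n + i)) (fun i j hij => hv (by omega)) vn vnn
    fun i => (hm (n + i)).trans_le ((min_le_right _ _).trans (min_le_left _ _))
  have r3 := H3 (n + n) v hv v0 vnn
    fun i => (hm i).trans_le ((min_le_right _ _).trans (min_le_right _ _))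
  rw [Finset.sum_range_add] at r3
  simp only [add_assoc] at r2 r3
  rw [abs_lt] at r1 r2 r3
  rw [Real.dist_eq, abs_le]
  constructor <;> linarith [r1.1, r1.2, r2.1, r2.2, r3.1, r3.2]

theorem HasRSIntegral.unique {f g : ℝ → ℝ} {a b I J : ℝ} (hab : a ≤ b)
    (hI : HasRSIntegral f g a b I) (hJ : HasRSIntegral f g a b J) : I = J := by
  refine eq_of_forall_dist_le fun ε hε => ?_
  obtain ⟨δ1, h1, H1⟩ := hI.sum_seq (show 0 < ε / 2 by positivity)
  obtain ⟨δ2, h2, H2⟩ := hJ.sum_seq (show 0 < ε / 2 by positivity)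
  obtain ⟨n, v, hv, v0, -, vnn, hm⟩ :=
    exists_fine_seq hab (le_refl b) (show 0 < min δ1 δ2 by positivity)
  have r1 := H1 (n + n) v hv v0 vnn fun i => (hm i).trans_le (min_le_left _ _)
  have r2 := H2 (n + n) v hv v0 vnn fun i => (hm i).trans_le (min_le_right _ _)
  rw [abs_lt] at r1 r2
  rw [Real.dist_eq, abs_le]
  constructor <;> linarith [r1.1, r1.2, r2.1, r2.2]

theorem sum_increments {n : ℕ} (u : Fin (n + 1) → ℝ) (g : ℝ → ℝ) :
    ∑ i : Fin n, (g (u i.succ) - g (u i.castSucc)) = g (u (Fin.last n)) - g (u 0) := by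
  have h := Fin.sum_univ_succ (fun i => g (u i))
  rw [Fin.sum_univ_castSucc (fun i => g (u i))] at h
  rw [Finset.sum_sub_distrib]
  linarith

/-- Changing the integrand by a constant on the interval of integration. -/
theorem HasRSIntegral.add_const {f f' g : ℝ → ℝ} {a b I c : ℝ} (h : HasRSIntegral f g a b I)
    (hf : ∀ x ∈ Icc a b, f' x = f x + c) :
    HasRSIntegral f' g a b (I + c * (g b - g a)) := by
  intro ε hε
  obtain ⟨δ, hδ, H⟩ := h ε hε
  refine ⟨δ, hδ, fun n u ξ hu h0 hn hm => ?_⟩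
  have := H n u ξ hu h0 hn hm
  have e : ∑ i : Fin n, f' (ξ i) * (g (u i.succ) - g (u i.castSucc)) =
      ∑ i : Fin n, f (ξ i) * (g (u i.succ) - g (u i.castSucc)) + c * (g b - g a) := by
    rw [← hn, ← h0, ← sum_increments u g, Finset.mul_sum, ← Finset.sum_add_distrib]
    refine Finset.sum_congr rfl fun i _ => ?_
    rw [hf (ξ i) ⟨?_, ?_⟩]
    · ring
    · rw [← h0]; exact (hu (Fin.zero_le _)).trans (hm i).2.1
    · rw [← hn]; exact (hm i).2.2.trans (hu (Fin.le_last _))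
  rw [e]
  simpa using this

theorem hasRSIntegral_zero (g : ℝ → ℝ) (a b : ℝ) : HasRSIntegral (fun _ => 0) g a b 0 :=
  fun ε hε => ⟨1, one_pos, fun n u ξ _ _ _ _ => by simpa using hε⟩

/-! ### Chen's identity for iterated integrals of order at most two. -/

section Signature

variable {d : ℕ} {T : ℝ} {x : ℝ → EuclideanSpace ℝ (Fin d)} {S : ℝ → ℝ → TensorSeries d}

theorem IsSignature.level_one (h : IsSignature T x S) {s t : ℝ} (hs : 0 ≤ s) (hst : s ≤ t)
    (ht : t ≤ T) (w : Fin 1 → Fin d) : S s t 1 w = x t (w 0) - x s (w 0) := by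
  have h1 := (h s t hs hst ht).2 0 Fin.elim0 (w 0)
  have h2 : HasRSIntegral (fun u => S s u 0 Fin.elim0) (fun u => x u (w 0)) s t
      (0 + 1 * (x t (w 0) - x s (w 0))) :=
    (hasRSIntegral_zero _ s t).add_const (fun u hu => by
      rw [(h s u hs hu.1 (hu.2.trans ht)).1, zero_add])
  have h3 := h1.unique hst h2
  have e : (Fin.snoc (α := fun _ => Fin d) Fin.elim0 (w 0) : Fin 1 → Fin d) = w := by
    ext i
    have : i = Fin.last 0 := Subsingleton.elim (α := Fin 1) _ _
    rw [this, Fin.snoc_last]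
    rfl
  rw [← e, h3]
  simp [Fin.snoc]

/-- On [u, t] the integrand S^1_{s,r} exceeds S^1_{u,r} by the constant S^1_{s,u}, which integrates
to the cross term. -/
theorem IsSignature.level_two (h : IsSignature T x S) {s u t : ℝ} (hs : 0 ≤ s) (hsu : s ≤ u)
    (hut : u ≤ t) (ht : t ≤ T) (i j : Fin d) :
    S s t 2 ![i, j] = S s u 2 ![i, j] + (S u t 2 ![i, j] +
      S s u 1 ![i] * S u t 1 ![j]) := by
  have e : ∀ a b, S a b 2 (Fin.snoc (α := fun _ => Fin d) ![i] j) = S a b 2 ![i, j] := by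
    intro a b
    congr 1
    ext q
    fin_cases q <;> rfl
  have h1 := (h s t hs (hsu.trans hut) ht).2 1 ![i] j
  have h2 := (h s u hs hsu (hut.trans ht)).2 1 ![i] j
  have h3 := (h u t (hs.trans hsu) hut ht).2 1 ![i] j
  have h4 := h3.add_const (f' := fun r => S s r 1 ![i]) (c := S s u 1 ![i]) (fun r hr => by
    rw [h.level_one hs (hsu.trans hr.1) (hr.2.trans ht), h.level_one hs hsu (hut.trans ht),
      h.level_one (hs.trans hsu) hr.1 (hr.2.trans ht)]
    ring)
  rw [e] at h1 h2 h4
  rw [h2.add_adjacent hsu hut h4 h1, h.level_one (hs.trans hsu) hut ht]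
  rfl

/-- Chen's identity for the iterated integrals of order at most two. -/
theorem IsSignature.chen_two (h : IsSignature T x S) {s u t : ℝ} (hs : 0 ≤ s) (hsu : s ≤ u)
    (hut : u ≤ t) (ht : t ≤ T) {k : ℕ} (hk : k ≤ 2) :
    (S s u).mul (S u t) k = S s t k := by
  have z1 := (h s u hs hsu (hut.trans ht)).1
  have z2 := (h u t (hs.trans hsu) hut ht).1
  have z3 := (h s t hs (hsu.trans hut) ht).1
  ext w
  interval_cases k
  · rw [mul_zero_level z1 z2, z3]
  · rw [mul_apply, Finset.sum_range_succ, Finset.sum_range_one, mulTerm_zero z1, mulTerm_self z2,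
      Pi.add_apply, h.level_one hs (hsu.trans hut) ht, h.level_one hs hsu (hut.trans ht),
      h.level_one (hs.trans hsu) hut ht]
    ring
  · rw [mul_apply, Finset.sum_range_succ, Finset.sum_range_succ, Finset.sum_range_one,
      mulTerm_zero z1, mulTerm_self z2, Pi.add_apply, Pi.add_apply,
      mulTerm_eq_tmul _ _ _ _ (by norm_num)]
    have hw : w = ![w 0, w 1] := by ext q; fin_cases q <;> rfl
    have h5 := h.level_two hs hsu hut ht (w 0) (w 1)
    rw [← hw] at h5
    rw [h5]
    have e1 : (fun q : Fin 1 => w (Fin.cast (by norm_num) (Fin.castAdd (2 - 1) q))) = ![w 0] := by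
      ext q; fin_cases q; rfl
    have e2 : (fun q : Fin (2 - 1) => w (Fin.cast (by norm_num) (Fin.natAdd 1 q))) = ![w 1] := by
      ext q; fin_cases q; rfl
    unfold tmul
    rw [e1, e2]
    ring

end Signature

/-! ### Chen's identity for the given rough path. -/

/-- The partition 0 ≤ s ≤ t ≤ T has [s, t] as one of its intervals. -/
theorem seminorm_le_pVarDist {d n : ℕ} (N : ∀ k, Seminorm ℝ (Tensor d k)) {p T : ℝ} (hp : 0 < p)
    (rx ry : ℝ → ℝ → TruncTensor d n) (i : Fin (n + 1)) (hi : 1 ≤ (i : ℕ)) {s t : ℝ}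
    (hs : 0 ≤ s) (hst : s ≤ t) (ht : t ≤ T) :
    ENNReal.ofReal (N i (rx s t i - ry s t i)) ≤ pVarDist N p T rx ry := by
  have hi' : (0 : ℝ) < i := by exact_mod_cast hi
  set u : Fin 4 → ℝ := ![0, s, t, T] with hu
  have hmono : Monotone u := by
    rw [Fin.monotone_iff_le_succ]
    intro q
    fin_cases q
    · exact hs
    · exact hst
    · exact ht
  have h1 : (∑ l : Fin 3, ENNReal.ofReal
      (N i (rx (u l.castSucc) (u l.succ) i - ry (u l.castSucc) (u l.succ) i)) ^ (p / (i : ℝ))) ^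
        ((i : ℝ) / p) ≤ pVarDist N p T rx ry := by
    unfold pVarDist
    exact le_iSup_of_le i (le_iSup_of_le hi (le_iSup_of_le 3 (le_iSup_of_le u
      (le_iSup_of_le ⟨hmono, rfl, rfl⟩ le_rfl))))
  refine le_trans ?_ h1
  have h2 : ENNReal.ofReal (N i (rx s t i - ry s t i)) ^ (p / (i : ℝ)) ≤
      ∑ l : Fin 3, ENNReal.ofReal
      (N i (rx (u l.castSucc) (u l.succ) i - ry (u l.castSucc) (u l.succ) i)) ^ (p / (i : ℝ)) :=
    Finset.single_le_sum (f := fun l : Fin 3 => ENNReal.ofReal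
      (N i (rx (u l.castSucc) (u l.succ) i - ry (u l.castSucc) (u l.succ) i)) ^ (p / (i : ℝ)))
      (fun _ _ => zero_le) (Finset.mem_univ (1 : Fin 3))
  calc ENNReal.ofReal (N i (rx s t i - ry s t i))
      = (ENNReal.ofReal (N i (rx s t i - ry s t i)) ^ (p / (i : ℝ))) ^ ((i : ℝ) / p) := by
        rw [← ENNReal.rpow_mul, show p / (i : ℝ) * ((i : ℝ) / p) = 1 by field_simp,
          ENNReal.rpow_one]
    _ ≤ _ := ENNReal.rpow_le_rpow h2 (by positivity)

/-- A rough path as a tensor series, with zero entries above its level. -/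
def TruncTensor.toSeries {d n : ℕ} (ξ : TruncTensor d n) : TensorSeries d :=
  fun k => if h : k < n + 1 then ξ ⟨k, h⟩ else 0

theorem toSeries_apply {d n : ℕ} (ξ : TruncTensor d n) {k : ℕ} (h : k < n + 1) :
    TruncTensor.toSeries ξ k = ξ ⟨k, h⟩ := dif_pos h

/-- Convergence in p-variation forces pointwise convergence of every coefficient, and Chen's
identity is polynomial in the coefficients. -/
theorem toSeries_chen {d : ℕ} {N : ∀ k, Seminorm ℝ (Tensor d k)} (hN : CompatibleNorms N)
    {β T : ℝ} (hβ : 0 < β) (hn : ⌊1 / β⌋₊ = 2) {y : ℝ → EuclideanSpace ℝ (Fin d)}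
    {ry : ℝ → ℝ → TruncTensor d ⌊1 / β⌋₊} (hry : IsGeometricHolderRoughPath N β T y ry)
    {s u t : ℝ} (hs : 0 ≤ s) (hsu : s ≤ u) (hut : u ≤ t) (ht : t ≤ T) {k : ℕ} (hk : k ≤ 2) :
    (ry s u).toSeries.mul (ry u t).toSeries k = (ry s t).toSeries k := by
  obtain ⟨x, rx, hx, hlim⟩ := hry.geometric
  choose hc hbv S hS hSr using hx
  have hconv : ∀ s t, 0 ≤ s → s ≤ t → t ≤ T → ∀ k, k ≤ 2 → ∀ w,
      Tendsto (fun m => S m s t k w) atTop (𝓝 ((ry s t).toSeries k w)) := by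
    intro s t hs hst ht k hk w
    have hkn : k < ⌊1 / β⌋₊ + 1 := by omega
    rcases Nat.eq_zero_or_pos k with rfl | hk0
    · have e : (ry s t).toSeries 0 w = 1 := by
        rw [toSeries_apply _ hkn]
        exact hry.level_zero s t hs hst ht w
      rw [e]
      refine tendsto_const_nhds.congr fun m => ((hS m s t hs hst ht).1 w).symm
    · obtain ⟨c, hc0, hc⟩ := norm_le_seminorm (N k) (hN.eq_zero k)
      rw [toSeries_apply _ hkn]
      have h1 : Tendsto (fun m => N k (rx m s t ⟨k, hkn⟩ - ry s t ⟨k, hkn⟩)) atTop (𝓝 0) := by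
        have h2 : Tendsto (fun m => ENNReal.ofReal (N k (rx m s t ⟨k, hkn⟩ - ry s t ⟨k, hkn⟩)))
            atTop (𝓝 0) :=
          tendsto_of_tendsto_of_tendsto_of_le_of_le tendsto_const_nhds hlim
            (fun m => zero_le)
            (fun m => seminorm_le_pVarDist N (by positivity) (rx m) ry ⟨k, hkn⟩ hk0 hs hst ht)
        have h3 := (ENNReal.tendsto_toReal ENNReal.zero_ne_top).comp h2
        rw [ENNReal.toReal_zero] at h3
        exact h3.congr fun m => ENNReal.toReal_ofReal (apply_nonneg _ _)
      rw [tendsto_iff_dist_tendsto_zero]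
      refine squeeze_zero (fun _ => dist_nonneg) (fun m => ?_) (by simpa using h1.const_mul c)
      rw [Real.dist_eq]
      have h4 : S m s t k w = rx m s t ⟨k, hkn⟩ w := by
        rw [hSr m s t hs hst ht]; rfl
      rw [h4]
      exact (norm_le_pi_norm (rx m s t ⟨k, hkn⟩ - ry s t ⟨k, hkn⟩) w).trans (hc _)
  ext w
  have h1 : Tendsto (fun m => (S m s u).mul (S m u t) k w) atTop
      (𝓝 ((ry s u).toSeries.mul (ry u t).toSeries k w)) := by
    unfold TensorSeries.mul tmul
    refine tendsto_finsetSum _ fun j _ => Tendsto.mul ?_ ?_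
    · exact hconv s u hs hsu (hut.trans ht) j (by omega) _
    · exact hconv u t (hs.trans hsu) hut ht _ (by omega) _
  have h2 := hconv s t hs (hsu.trans hut) ht k hk w
  refine tendsto_nhds_unique h1 (h2.congr fun m => ?_)
  rw [(hS m).chen_two hs hsu hut ht hk]

/-! ### Existence: extension level by level. -/

/-- `Y` is a multiplicative functional up to level `n` satisfying the factorial-type bounds with
constants `L` and `α`. -/
structure IsPartialExtension {d : ℕ} (N : ∀ k, Seminorm ℝ (Tensor d k)) (β T L α : ℝ) (n : ℕ)
    (Y : ℝ → ℝ → TensorSeries d) : Prop where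
  level_zero : ∀ s t, 0 ≤ s → s ≤ t → t ≤ T → ∀ w, Y s t 0 w = 1
  chen : ∀ k ≤ n, ∀ s u t, 0 ≤ s → s ≤ u → u ≤ t → t ≤ T → (Y s u).mul (Y u t) k = Y s t k
  bound : ∀ k, 1 ≤ k → k ≤ n → ∀ s t, 0 ≤ s → s ≤ t → t ≤ T →
    N k (Y s t k) ≤ compCoeff β k * L ^ k / α * (t - s) ^ ((k : ℝ) * β)

/-- Associativity of P_{0,s} ⊗ P_{s,u} ⊗ P_{u,t} at level k, where the inner products may be
replaced by P_{0,u} and P_{s,t} up to their own level k terms. -/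
theorem update_level_chen {d : ℕ} {T : ℝ} {P : ℝ → ℝ → TensorSeries d} {k : ℕ}
    (P0 : ∀ s t, 0 ≤ s → s ≤ t → t ≤ T → ∀ w, P s t 0 w = 1)
    (hP : ∀ j < k, ∀ s u t, 0 ≤ s → s ≤ u → u ≤ t → t ≤ T → (P s u).mul (P u t) j = P s t j)
    (hPk : ∀ s t, P s t k = 0) {s u t : ℝ} (hs : 0 ≤ s) (hsu : s ≤ u) (hut : u ≤ t) (ht : t ≤ T) :
    (P 0 u).mul (P u t) k + (P 0 s).mul (P s u) k =
      (P 0 s).mul (P s t) k + (P s u).mul (P u t) k := by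
  have h := congrFun (mul_assoc' (P 0 s) (P s u) (P u t)) k
  have hu := hs.trans hsu
  have hst := hsu.trans hut
  rw [mul_change_left (ξ' := P 0 u) (P0 u t hu hut ht)
      (fun j hj => hP j hj 0 s u le_rfl hs hsu (hut.trans ht)), hPk, sub_zero,
    mul_change_right (η' := P s t) (P0 0 s le_rfl hs (hst.trans ht))
      (fun j hj => hP j hj s u t hs hsu hut ht), hPk, sub_zero] at h
  exact h

/-- Sewing of a cochain with a prescribed coboundary, with the constant given by bisection. -/
theorem exists_cochain {d k : ℕ} (p : Seminorm ℝ (Tensor d k)) (hp : ∀ ξ, p ξ = 0 → ξ = 0)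
    {θ T G : ℝ} (hθ : 1 < θ) (hT : 0 ≤ T) (hG : 0 ≤ G) {E : ℝ → ℝ → Tensor d k}
    {D : ℝ → ℝ → ℝ → Tensor d k}
    (hE : ∀ s u t, 0 ≤ s → s ≤ u → u ≤ t → t ≤ T → E u t + E s u = E s t + D s u t)
    (hD : ∀ s u t, 0 ≤ s → s ≤ u → u ≤ t → t ≤ T → ∀ h, u - s ≤ h → t - u ≤ h →
      p (D s u t) ≤ G * h ^ θ) :
    ∃ Z : ℝ → ℝ → Tensor d k,
      (∀ s u t, 0 ≤ s → s ≤ u → u ≤ t → t ≤ T → Z s t = D s u t + Z s u + Z u t) ∧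
      ∀ s t, 0 ≤ s → s ≤ t → t ≤ T →
        p (Z s t) ≤ G * (2 ^ θ)⁻¹ / (1 - 2 ^ (1 - θ)) * (t - s) ^ θ := by
  obtain ⟨c1, hc1, hnorm⟩ := norm_le_seminorm p hp
  obtain ⟨c2, hc2, hsemi⟩ := seminorm_le_norm p
  have hDE : ∀ s u t, 0 ≤ s → s ≤ u → u ≤ t → t ≤ T → D s u t = E u t + E s u - E s t := by
    intro s u t hs hsu hut ht
    rw [hE s u t hs hsu hut ht, add_sub_cancel_left]
  obtain ⟨φ, hφ⟩ := sewing (Ξ := fun s t => -E s t) (M := c1 * G) hθ hT (by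
    intro s u t hs hsu hut ht
    have e : -E s t - -E s u - -E u t = D s u t := by
      rw [hDE s u t hs hsu hut ht]
      abel
    rw [e, mul_assoc]
    exact (hnorm _).trans (mul_le_mul_of_nonneg_left
      (hD s u t hs hsu hut ht _ (by linarith) (by linarith)) hc1))
  have hZadd : ∀ s u t, 0 ≤ s → s ≤ u → u ≤ t → t ≤ T → -E s t - (φ t - φ s) =
      D s u t + (-E s u - (φ u - φ s)) + (-E u t - (φ t - φ u)) := by
    intro s u t hs hsu hut ht
    rw [hDE s u t hs hsu hut ht]
    abel
  refine ⟨fun s t => -E s t - (φ t - φ s), hZadd, fun s t hs hst ht => ?_⟩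
  -- Sewing supplies only the a priori bound, with the norm-equivalence constants c1 and c2;
  -- bisection removes them. Halving the interval produces (2 ^ θ)⁻¹.
  refine le_of_bisection (f := fun s t => p (-E s t - (φ t - φ s))) (a := G * (2 ^ θ)⁻¹) hθ
    (M := c2 * (2 * (c1 * G) / (1 - 2 ^ (1 - θ)))) (fun s t hs hst ht => ?_)
    (fun s t hs hst ht => ?_) hs hst ht (by positivity)
  · rw [mul_assoc]
    exact (hsemi _).trans (mul_le_mul_of_nonneg_left (hφ s t hs hst ht) hc2)
  · have h1 := hZadd s ((s + t) / 2) t hs (by linarith) (by linarith) ht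
    have h2 := hD s ((s + t) / 2) t hs (by linarith) (by linarith) ht ((t - s) / 2)
      (by linarith) (by linarith)
    rw [Real.div_rpow (by linarith) (by norm_num)] at h2
    have h3 : p (D s ((s + t) / 2) t) ≤ G * (2 ^ θ)⁻¹ * (t - s) ^ θ :=
      h2.trans (le_of_eq (by ring))
    rw [h1]
    have h4 := map_add_le_add p (D s ((s + t) / 2) t + (-E s ((s + t) / 2) -
      (φ ((s + t) / 2) - φ s))) (-E ((s + t) / 2) t - (φ t - φ ((s + t) / 2)))
    have h5 := map_add_le_add p (D s ((s + t) / 2) t) (-E s ((s + t) / 2) -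
      (φ ((s + t) / 2) - φ s))
    linarith

/-- Products carry α⁻² where α⁻¹ is wanted; the spare factor pays for the α in the convolution
estimate. -/
theorem scaled_compCoeff_conv_le {β L : ℝ} (hβ : 1 / 3 < β) (hβ' : β < 1 / 2) (hL : 0 ≤ L) {k : ℕ}
    (hk : 3 ≤ k) :
    (∑ j ∈ Finset.Ico 1 k, compCoeff β j * L ^ j / alphaConst β *
      (compCoeff β (k - j) * L ^ (k - j) / alphaConst β)) * (2 ^ ((k : ℝ) * β))⁻¹ /
        (1 - 2 ^ (1 - (k : ℝ) * β)) ≤ compCoeff β k * L ^ k / alphaConst β := by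
  have hα := alphaConst_pos hβ
  have hk3 : (3 : ℝ) ≤ k := by exact_mod_cast hk
  have hr := two_rpow_one_sub_lt_one (θ := (k : ℝ) * β) (by nlinarith)
  have hconv := compCoeff_conv_le hβ hβ' hk
  rw [div_le_iff₀ (by linarith)]
  have e : (∑ j ∈ Finset.Ico 1 k, compCoeff β j * L ^ j / alphaConst β *
      (compCoeff β (k - j) * L ^ (k - j) / alphaConst β)) =
      L ^ k / alphaConst β ^ 2 *
        ∑ j ∈ Finset.Ico 1 k, compCoeff β j * compCoeff β (k - j) := by
    rw [Finset.mul_sum]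
    refine Finset.sum_congr rfl fun j hj => ?_
    rw [Finset.mem_Ico] at hj
    have : L ^ k = L ^ j * L ^ (k - j) := by rw [← pow_add]; congr 1; omega
    rw [this]
    field_simp
  rw [e, mul_assoc]
  refine (mul_le_mul_of_nonneg_left hconv (by positivity)).trans (le_of_eq ?_)
  field_simp

theorem mul_level_congr {d : ℕ} {ξ ξ' η η' : TensorSeries d} {k : ℕ} (h : ∀ j ≤ k, ξ j = ξ' j)
    (h' : ∀ j ≤ k, η j = η' j) : ξ.mul η k = ξ'.mul η' k := by
  rw [mul_apply, mul_apply]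
  refine Finset.sum_congr rfl fun i hi => ?_
  rw [Finset.mem_range] at hi
  exact mulTerm_congr (by omega) (h _ (by omega)) (h' _ (by omega))

/-- The bound for the defect of additivity at the level `k`. -/
theorem defect_bound {d : ℕ} {N : ∀ k, Seminorm ℝ (Tensor d k)} (hN : CompatibleNorms N)
    {β T : ℝ} (hβ : 0 < β) {g : ℕ → ℝ} (hg : ∀ j, 0 ≤ g j) {k : ℕ} {P : ℝ → ℝ → TensorSeries d}
    (P0 : ∀ s t, 0 ≤ s → s ≤ t → t ≤ T → ∀ w, P s t 0 w = 1) (hPk : ∀ s t, P s t k = 0)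
    (hb : ∀ j, 1 ≤ j → j < k → ∀ s t, 0 ≤ s → s ≤ t → t ≤ T →
      N j (P s t j) ≤ g j * (t - s) ^ ((j : ℝ) * β))
    {s u t : ℝ} (hs : 0 ≤ s) (hsu : s ≤ u) (hut : u ≤ t) (ht : t ≤ T) {h : ℝ} (h1 : u - s ≤ h)
    (h2 : t - u ≤ h) :
    N k ((P s u).mul (P u t) k) ≤
      (∑ j ∈ Finset.Ico 1 k, g j * g (k - j)) * h ^ ((k : ℝ) * β) := by
  have hh : 0 ≤ h := by linarith
  refine (seminorm_mul_le hN (P0 s u hs hsu (hut.trans ht)) (P0 u t (hs.trans hsu) hut ht)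
    (hPk _ _) (hPk _ _)).trans ?_
  rw [Finset.sum_mul]
  refine Finset.sum_le_sum fun j hj => ?_
  rw [Finset.mem_Ico] at hj
  have c1 : N j (P s u j) ≤ g j * h ^ ((j : ℝ) * β) :=
    (hb j hj.1 hj.2 s u hs hsu (hut.trans ht)).trans (mul_le_mul_of_nonneg_left
      (Real.rpow_le_rpow (by linarith) h1 (by positivity)) (hg j))
  have c2 : N (k - j) (P u t (k - j)) ≤ g (k - j) * h ^ (((k - j : ℕ) : ℝ) * β) :=
    (hb (k - j) (by omega) (by omega) u t (hs.trans hsu) hut ht).trans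
      (mul_le_mul_of_nonneg_left (Real.rpow_le_rpow (by linarith) h2 (by positivity)) (hg _))
  calc _ ≤ (g j * h ^ ((j : ℝ) * β)) * (g (k - j) * h ^ (((k - j : ℕ) : ℝ) * β)) :=
        mul_le_mul c1 c2 (apply_nonneg _ _) (mul_nonneg (hg j) (Real.rpow_nonneg hh _))
    _ = g j * g (k - j) * (h ^ ((j : ℝ) * β) * h ^ (((k - j : ℕ) : ℝ) * β)) := by ring
    _ = _ := by
        rw [← Real.rpow_add_of_nonneg hh (by positivity) (by positivity), Nat.cast_sub hj.2.le]
        ring_nf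

/-- A partial extension up to level `n` extends to the level `n + 1`. -/
theorem IsPartialExtension.extend {d : ℕ} {N : ∀ k, Seminorm ℝ (Tensor d k)}
    (hN : CompatibleNorms N) {β T L : ℝ} (hβ : 1 / 3 < β) (hβ' : β < 1 / 2) (hT : 0 ≤ T)
    (hL : 0 ≤ L) {n : ℕ} (hn : 2 ≤ n) {Y : ℝ → ℝ → TensorSeries d}
    (hY : IsPartialExtension N β T L (alphaConst β) n Y) :
    ∃ Y' : ℝ → ℝ → TensorSeries d, IsPartialExtension N β T L (alphaConst β) (n + 1) Y' ∧
      ∀ s t, ∀ k ≤ n, Y' s t k = Y s t k := by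
  have hβ0 : 0 < β := by linarith
  have hα := alphaConst_pos hβ
  obtain ⟨k, hk⟩ : ∃ k, k = n + 1 := ⟨_, rfl⟩
  rw [← hk]
  have hk3 : (3 : ℝ) ≤ k := by exact_mod_cast (by omega : 3 ≤ k)
  have hθ : 1 < (k : ℝ) * β := by nlinarith
  have hg : ∀ j, 0 ≤ compCoeff β j * L ^ j / alphaConst β := fun j =>
    div_nonneg (mul_nonneg (compCoeff_nonneg hβ0 j) (pow_nonneg hL j)) hα.le
  have upd : ∀ V : ℝ → ℝ → Tensor d k, ∃ Q : ℝ → ℝ → TensorSeries d,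
      (∀ s t, ∀ j ≤ n, Q s t j = Y s t j) ∧ ∀ s t, Q s t k = V s t := fun V =>
    ⟨fun s t => Function.update (Y s t) k (V s t),
      fun s t j hj => Function.update_of_ne (by omega) _ _, fun s t => Function.update_self _ _ _⟩
  have hmul : ∀ Q : ℝ → ℝ → TensorSeries d, (∀ s t, ∀ j ≤ n, Q s t j = Y s t j) →
      ∀ j < k, ∀ s u t, 0 ≤ s → s ≤ u → u ≤ t → t ≤ T → (Q s u).mul (Q u t) j = Q s t j := by
    intro Q hQ j hj s u t hs hsu hut ht
    rw [hQ s t j (by omega), ← hY.chen j (by omega) s u t hs hsu hut ht]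
    exact mul_level_congr (fun i hi => hQ _ _ _ (by omega)) (fun i hi => hQ _ _ _ (by omega))
  have hone : ∀ Q : ℝ → ℝ → TensorSeries d, (∀ s t, ∀ j ≤ n, Q s t j = Y s t j) →
      ∀ s t, 0 ≤ s → s ≤ t → t ≤ T → ∀ w, Q s t 0 w = 1 := fun Q hQ s t hs hst ht w => by
    rw [hQ s t 0 (by omega)]; exact hY.level_zero s t hs hst ht w
  obtain ⟨P, hPj, hPk⟩ := upd fun _ _ => 0
  have P0 := hone P hPj
  have hb : ∀ j, 1 ≤ j → j < k → ∀ s t, 0 ≤ s → s ≤ t → t ≤ T →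
      N j (P s t j) ≤ compCoeff β j * L ^ j / alphaConst β * (t - s) ^ ((j : ℝ) * β) := by
    intro j hj1 hj s t hs hst ht
    rw [hPj s t j (by omega)]
    exact hY.bound j hj1 (by omega) s t hs hst ht
  obtain ⟨Z, hZadd, hZ⟩ := exists_cochain (N k) (hN.eq_zero k) hθ hT
    (Finset.sum_nonneg fun j _ => mul_nonneg (hg j) (hg (k - j)))
    (E := fun s t => (P 0 s).mul (P s t) k) (D := fun s u t => (P s u).mul (P u t) k)
    (fun s u t hs hsu hut ht => update_level_chen P0 (hmul P hPj) hPk hs hsu hut ht)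
    (fun s u t hs hsu hut ht h h1 h2 => defect_bound hN hβ0 hg P0 hPk hb hs hsu hut ht h1 h2)
  obtain ⟨Y', hYj, hYk⟩ := upd Z
  have Y0 := hone Y' hYj
  refine ⟨Y', ⟨Y0, ?_, ?_⟩, hYj⟩
  · intro j hj s u t hs hsu hut ht
    rcases Nat.lt_or_ge j k with hjk | hjk
    · exact hmul Y' hYj j hjk s u t hs hsu hut ht
    · obtain rfl : j = k := le_antisymm hj hjk
      -- Y' and P agree below level k, so replacing one by the other adds just Z s u and Z u t to
      -- the defect.
      rw [mul_change_left (ξ' := P s u) (Y0 u t (hs.trans hsu) hut ht)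
          (fun i hi => by rw [hYj _ _ i (by omega), hPj _ _ i (by omega)]),
        mul_change_right (η' := P u t) (P0 s u hs hsu (hut.trans ht))
          (fun i hi => by rw [hYj _ _ i (by omega), hPj _ _ i (by omega)]),
        hPk, hPk, sub_zero, sub_zero, hYk, hYk, hYk, hZadd s u t hs hsu hut ht]
      abel
  · intro j hj1 hj s t hs hst ht
    rcases Nat.lt_or_ge j k with hjk | hjk
    · rw [hYj _ _ j (by omega)]
      exact hY.bound j hj1 (by omega) s t hs hst ht
    · obtain rfl : j = k := le_antisymm hj hjk
      rw [hYk]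
      exact (hZ s t hs hst ht).trans (mul_le_mul_of_nonneg_right
        (scaled_compCoeff_conv_le hβ hβ' hL (by omega)) (Real.rpow_nonneg (by linarith) _))

/-- A partial extension extends to all levels. -/
theorem IsPartialExtension.exists_full {d : ℕ} {N : ∀ k, Seminorm ℝ (Tensor d k)}
    (hN : CompatibleNorms N) {β T L : ℝ} (hβ : 1 / 3 < β) (hβ' : β < 1 / 2) (hT : 0 ≤ T)
    (hL : 0 ≤ L) {Y : ℝ → ℝ → TensorSeries d}
    (hY : IsPartialExtension N β T L (alphaConst β) 2 Y) :
    ∃ Y' : ℝ → ℝ → TensorSeries d,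
      (∀ n, IsPartialExtension N β T L (alphaConst β) n Y') ∧
      ∀ s t, ∀ k ≤ 2, Y' s t k = Y s t k := by
  choose! next hnext hnextj using fun (n : ℕ) (hn : 2 ≤ n) (Y : ℝ → ℝ → TensorSeries d)
    (hY : IsPartialExtension N β T L (alphaConst β) n Y) =>
    IsPartialExtension.extend hN hβ hβ' hT hL hn hY
  set W : ℕ → ℝ → ℝ → TensorSeries d :=
    fun n => Nat.rec Y (fun m V => next (m + 2) V) n with hW
  have hWs : ∀ n, W (n + 1) = next (n + 2) (W n) := fun n => rfl
  have hWp : ∀ n, IsPartialExtension N β T L (alphaConst β) (n + 2) (W n) := by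
    intro n
    induction n with
    | zero => exact hY
    | succ n ih => rw [hWs]; exact hnext (n + 2) (by omega) _ ih
  have hWj : ∀ n m, n ≤ m → ∀ s t, ∀ k ≤ n + 2, W m s t k = W n s t k := by
    intro n m hnm
    induction m, hnm using Nat.le_induction with
    | base => intro s t k _; rfl
    | succ m hm ih =>
      intro s t k hk
      rw [hWs, hnextj (m + 2) (by omega) _ (hWp m) s t k (by omega), ih s t k hk]
  have hdiag : ∀ n s t, ∀ k ≤ n + 2, W k s t k = W n s t k := by
    intro n s t k hk
    rcases le_total k n with h | h
    · exact (hWj k n h s t k (by omega)).symm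
    · exact hWj n k h s t k hk
  -- Diagonal choice: W k is already correct through level k + 2, and later steps leave those levels
  -- unchanged.
  refine ⟨fun s t k => W k s t k, fun n => ⟨?_, ?_, ?_⟩, fun s t k hk => hdiag 0 s t k hk⟩
  · exact fun s t hs hst ht w => (hWp 0).level_zero s t hs hst ht w
  · intro k _ s u t hs hsu hut ht
    rw [← (hWp k).chen k (by omega) s u t hs hsu hut ht]
    exact mul_level_congr (fun i hi => hdiag k _ _ _ (by omega)) (fun i hi => hdiag k _ _ _ (by omega))
  · intro k hk1 _ s t hs hst ht
    exact (hWp k).bound k hk1 (by omega) s t hs hst ht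

/-! ### Uniqueness. -/

theorem IsControl.add {T : ℝ} {ω ω' : ℝ → ℝ → ℝ} (h : IsControl T ω) (h' : IsControl T ω') :
    IsControl T (fun s t => ω s t + ω' s t) where
  nonneg s t hs hst ht := add_nonneg (h.nonneg s t hs hst ht) (h'.nonneg s t hs hst ht)
  continuousOn := h.continuousOn.add h'.continuousOn
  diag t h0 ht := by rw [h.diag t h0 ht, h'.diag t h0 ht, add_zero]
  superadditive s u t hs hsu hut ht := by
    linarith [h.superadditive s u t hs hsu hut ht, h'.superadditive s u t hs hsu hut ht]

theorem isControl_linear {T c : ℝ} (hc : 0 ≤ c) : IsControl T (fun s t => c * (t - s)) where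
  nonneg s t hs hst ht := mul_nonneg hc (by linarith)
  continuousOn := by fun_prop
  diag t h0 ht := by ring
  superadditive s u t hs hsu hut ht := by linarith

theorem IsLyonsExtension.level_eq {d n : ℕ} {N : ∀ k, Seminorm ℝ (Tensor d k)} {β T : ℝ}
    {ry : ℝ → ℝ → TruncTensor d n} {Y : ℝ → ℝ → TensorSeries d} (h : IsLyonsExtension N β T ry Y)
    {k : ℕ} (hk : k < n + 1) {s t : ℝ} (hs : 0 ≤ s) (hst : s ≤ t) (ht : t ≤ T) :
    Y s t k = ry s t ⟨k, hk⟩ :=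
  congrFun (h.extends_path s t hs hst ht) ⟨k, hk⟩

/-- Uniqueness of the Lyons extension. -/
theorem IsLyonsExtension.unique {d n : ℕ} {N : ∀ k, Seminorm ℝ (Tensor d k)}
    (hN : CompatibleNorms N) {β T : ℝ} {ry : ℝ → ℝ → TruncTensor d n}
    (hβ : ∀ k : ℕ, n < k → 1 < (k : ℝ) * β)
    (h0 : ∀ s t, 0 ≤ s → s ≤ t → t ≤ T → ∀ w, ry s t 0 w = 1) {Y Y' : ℝ → ℝ → TensorSeries d}
    (h : IsLyonsExtension N β T ry Y) (h' : IsLyonsExtension N β T ry Y') (k : ℕ) :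
    ∀ s t, 0 ≤ s → s ≤ t → t ≤ T → Y' s t k = Y s t k := by
  have z : ∀ {V : ℝ → ℝ → TensorSeries d}, IsLyonsExtension N β T ry V →
      ∀ s t, 0 ≤ s → s ≤ t → t ≤ T → ∀ w, V s t 0 w = 1 := fun hV s t hs hst ht w => by
    rw [hV.level_eq (Nat.succ_pos n) hs hst ht]; exact h0 s t hs hst ht w
  induction k using Nat.strong_induction_on with
  | _ k ih =>
    rcases Nat.lt_or_ge k (n + 1) with hk | hk
    · intro s t hs hst ht
      rw [h.level_eq hk hs hst ht, h'.level_eq hk hs hst ht]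
    · intro s t hs hst ht
      have hθ := hβ k hk
      obtain ⟨ω, hω, hb⟩ := h.finite_variation k (by omega)
      obtain ⟨ω', hω', hb'⟩ := h'.finite_variation k (by omega)
      refine sub_eq_zero.mp (hN.eq_zero k _ (additive_eq_zero (N k)
        (Z := fun s t => Y' s t k - Y s t k) (c := 2) hθ (hω.add hω') ?_ ?_ (by norm_num)
        hs hst ht))
      -- Since lower levels agree, the mixed terms in Chen's identity cancel and the difference is
      -- additive.
      · intro s u t hs hsu hut ht
        rw [← h.chen s u t hs hsu hut ht, ← h'.chen s u t hs hsu hut ht,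
          mul_change_left (ξ' := Y s u) (z h' u t (hs.trans hsu) hut ht)
            (fun j hj => ih j hj s u hs hsu (hut.trans ht)),
          mul_change_right (η' := Y u t) (z h s u hs hsu (hut.trans ht))
            (fun j hj => ih j hj u t (hs.trans hsu) hut ht)]
        abel
      · intro s t hs hst ht
        have n1 := hω.nonneg s t hs hst ht
        have n2 := hω'.nonneg s t hs hst ht
        have e1 : ω s t ^ ((k : ℝ) * β) ≤ (ω s t + ω' s t) ^ ((k : ℝ) * β) :=
          Real.rpow_le_rpow n1 (by linarith) (by linarith)
        have e2 : ω' s t ^ ((k : ℝ) * β) ≤ (ω s t + ω' s t) ^ ((k : ℝ) * β) :=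
          Real.rpow_le_rpow n2 (by linarith) (by linarith)
        have := map_sub_le_add (N k) (Y' s t k) (Y s t k)
        linarith [hb s t hs hst ht, hb' s t hs hst ht]

/-! ### The constant K and the initial levels. -/

theorem KConst_bounds {β C : ℝ} (hβ : 1 / 3 < β) (hC : 0 ≤ C) :
    0 ≤ KConst β C ∧ alphaConst β * Real.Gamma β * C ≤ KConst β C ^ β ∧
      alphaConst β * Real.Gamma (2 * β) * C ≤ (KConst β C ^ β) ^ 2 := by
  have hβ0 : 0 < β := by linarith
  have hα := alphaConst_pos hβ
  have g1 := Real.Gamma_pos_of_pos hβ0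
  have g2 := Real.Gamma_pos_of_pos (show 0 < 2 * β by linarith)
  have p1 : 0 ≤ alphaConst β * Real.Gamma β * C := by positivity
  have p2 : 0 ≤ alphaConst β * Real.Gamma (2 * β) * C := by positivity
  have hK : 0 ≤ KConst β C := (Real.rpow_nonneg p1 (1 / β)).trans (le_max_left _ _)
  refine ⟨hK, ?_, ?_⟩
  · have := Real.rpow_le_rpow (Real.rpow_nonneg p1 _)
      (le_max_left _ _ : _ ≤ KConst β C) hβ0.le
    rwa [← Real.rpow_mul p1, one_div_mul_cancel hβ0.ne', Real.rpow_one] at this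
  · have := Real.rpow_le_rpow (Real.rpow_nonneg p2 _)
      (le_max_right _ _ : _ ≤ KConst β C) (show 0 ≤ 2 * β by linarith)
    rw [← Real.rpow_mul p2, one_div_mul_cancel (by positivity), Real.rpow_one] at this
    rwa [← Real.rpow_natCast, ← Real.rpow_mul hK, mul_comm β]

/-- The constant in the Hölder estimate is bounded by the Gamma-type constants on the two levels
of the rough path. -/
theorem holder_const_le {β C : ℝ} (hβ : 1 / 3 < β) (hC : 0 ≤ C) {k : ℕ} (hk1 : 1 ≤ k)
    (hk2 : k ≤ 2) :
    C ≤ (Real.Gamma (k * β))⁻¹ * (KConst β C ^ β) ^ k / alphaConst β := by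
  obtain ⟨-, h1, h2⟩ := KConst_bounds hβ hC
  have hα := alphaConst_pos hβ
  have hg : 0 < Real.Gamma (k * β) := Real.Gamma_pos_of_pos
    (mul_pos (by exact_mod_cast hk1) (by linarith))
  rw [le_div_iff₀ hα, ← div_eq_inv_mul, le_div_iff₀ hg]
  interval_cases k
  · norm_num at hg ⊢
    linarith
  · push_cast at hg ⊢
    linarith

theorem floor_one_div_eq_two {β : ℝ} (hβ : 1 / 3 < β) (hβ' : β < 1 / 2) : ⌊1 / β⌋₊ = 2 := by
  have hβ0 : 0 < β := by linarith
  rw [Nat.floor_eq_iff (by positivity)]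
  constructor
  · rw [le_div_iff₀ hβ0]; push_cast; linarith
  · rw [div_lt_iff₀ hβ0]; push_cast; linarith

theorem HolderEstimate.const_nonneg {d n : ℕ} {N : ∀ k, Seminorm ℝ (Tensor d k)} {β T C : ℝ}
    {ry : ℝ → ℝ → TruncTensor d n} (hC : HolderEstimate N β T C ry) (hn : 1 ≤ n) (hT : 0 < T) :
    0 ≤ C := by
  have h := (apply_nonneg _ _).trans (hC ⟨1, by omega⟩ le_rfl 0 T le_rfl hT.le le_rfl)
  exact nonneg_of_mul_nonneg_left h (Real.rpow_pos_of_pos (by linarith) _)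

end RoughTaylor

end

/-! ### Existence, uniqueness and the Gamma bound together. -/

theorem mainTheorem3 {d : ℕ} (N : ∀ k, Seminorm ℝ (RoughTaylor.Tensor d k))
    (hN : RoughTaylor.CompatibleNorms N) (β T C : ℝ) (hβ : 1 / 3 < β) (hβ' : β < 1 / 2)
    (hT : 0 < T) (y : ℝ → EuclideanSpace ℝ (Fin d))
    (ry : ℝ → ℝ → RoughTaylor.TruncTensor d ⌊1 / β⌋₊)
    (hry : RoughTaylor.IsGeometricHolderRoughPath N β T y ry)
    (hC : RoughTaylor.HolderEstimate N β T C ry) :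
    ∃ Y : ℝ → ℝ → RoughTaylor.TensorSeries d,
      RoughTaylor.IsLyonsExtension N β T ry Y ∧
      (∀ Y' : ℝ → ℝ → RoughTaylor.TensorSeries d, RoughTaylor.IsLyonsExtension N β T ry Y' →
        ∀ s t, 0 ≤ s → s ≤ t → t ≤ T → Y' s t = Y s t) ∧
      ∀ k : ℕ, 1 ≤ k → ∀ t, 0 < t → t ≤ T →
        N k (Y 0 t k) ≤ ((RoughTaylor.KConst β C * T) ^ β) ^ k /
          (RoughTaylor.alphaConst β * Real.Gamma (k * β)) := by
  open RoughTaylor in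
  have hβ0 : 0 < β := by linarith
  have hfl := floor_one_div_eq_two hβ hβ'
  have hC0 : 0 ≤ C := hC.const_nonneg (by omega) hT
  have hα := alphaConst_pos hβ
  have hK := (KConst_bounds hβ hC0).1
  have hL : 0 ≤ KConst β C ^ β := Real.rpow_nonneg hK _
  set L := KConst β C ^ β with hLdef
  have hsmall : ∀ k : ℕ, k ≤ 2 → (k : ℝ) * β ≤ 1 := fun k hk => by
    have : (k : ℝ) ≤ 2 := by exact_mod_cast hk
    nlinarith
  have hlarge : ∀ k : ℕ, 2 < k → 1 < (k : ℝ) * β := fun k hk => by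
    have : (3 : ℝ) ≤ k := by exact_mod_cast hk
    nlinarith
  have hX : IsPartialExtension N β T L (alphaConst β) 2 (fun s t => (ry s t).toSeries) := by
    refine IsPartialExtension.mk (fun s t hs hst ht w => ?_) (fun k hk s u t hs hsu hut ht =>
      toSeries_chen hN hβ0 hfl hry hs hsu hut ht hk) (fun k hk1 hk2 s t hs hst ht => ?_)
    · rw [toSeries_apply _ (Nat.succ_pos _)]
      exact hry.level_zero s t hs hst ht w
    · rw [toSeries_apply _ (show k < ⌊1 / β⌋₊ + 1 by omega)]
      refine (hC ⟨k, by omega⟩ hk1 s t hs hst ht).trans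
        (mul_le_mul_of_nonneg_right ?_ (Real.rpow_nonneg (by linarith) _))
      refine (holder_const_le hβ hC0 hk1 hk2).trans (div_le_div_of_nonneg_right
        (mul_le_mul_of_nonneg_right (inv_Gamma_le_compCoeff ?_ (hsmall k hk2))
          (pow_nonneg hL k)) hα.le)
      exact mul_pos (by exact_mod_cast hk1) hβ0
  obtain ⟨Y, hY, hYX⟩ := hX.exists_full hN hβ hβ' hT.le hL
  have hext : ∀ s t, (Y s t).trunc ⌊1 / β⌋₊ = ry s t := fun s t => by
    funext k
    have hk := k.isLt
    exact (hYX s t k (by omega)).trans (toSeries_apply _ hk)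
  have hLyons : IsLyonsExtension N β T ry Y := by
    refine ⟨fun s t _ _ _ => hext s t, fun s u t hs hsu hut ht =>
      funext fun k => (hY k).chen k le_rfl s u t hs hsu hut ht, fun k hk => ?_⟩
    have hk0 : 0 < (k : ℝ) * β := mul_pos (by exact_mod_cast hk) hβ0
    set c := compCoeff β k * L ^ k / alphaConst β
    have hc : 0 ≤ c := div_nonneg (mul_nonneg (compCoeff_nonneg hβ0 k) (pow_nonneg hL k)) hα.le
    -- The control is c^{1/(kβ)} (t - s), whose power kβ is the bound already proved.
    refine ⟨_, isControl_linear (Real.rpow_nonneg hc ((k : ℝ) * β)⁻¹), fun s t hs hst ht => ?_⟩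
    rw [Real.mul_rpow (Real.rpow_nonneg hc _) (by linarith), ← Real.rpow_mul hc,
      inv_mul_cancel₀ hk0.ne', Real.rpow_one]
    exact (hY k).bound k hk le_rfl s t hs hst ht
  refine ⟨Y, hLyons, fun Y' hY' s t hs hst ht => funext fun k =>
    hLyons.unique hN (fun k hk => hlarge k (by omega)) hry.level_zero hY' k s t hs hst ht,
    fun k hk t ht htT => ?_⟩
  have hk0 : 0 < (k : ℝ) * β := mul_pos (by exact_mod_cast hk) hβ0
  have hcoef : N k (Y 0 t k) ≤
      (Real.Gamma (k * β))⁻¹ * L ^ k / alphaConst β * t ^ ((k : ℝ) * β) := by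
    -- For k ≤ 2 the comparison coefficient is on the wrong side of 1/Γ(kβ), so the Hölder estimate
    -- is used directly.
    rcases Nat.lt_or_ge 2 k with hk2 | hk2
    · refine ((hY k).bound k hk le_rfl 0 t le_rfl ht.le htT).trans ?_
      rw [sub_zero]
      exact mul_le_mul_of_nonneg_right (div_le_div_of_nonneg_right (mul_le_mul_of_nonneg_right
        (compCoeff_le_inv_Gamma (hlarge k hk2).le) (pow_nonneg hL k)) hα.le)
        (Real.rpow_nonneg ht.le _)
    · rw [hLyons.level_eq (show k < ⌊1 / β⌋₊ + 1 by omega) le_rfl ht.le htT]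
      refine (hC ⟨k, by omega⟩ hk 0 t le_rfl ht.le htT).trans ?_
      rw [sub_zero]
      exact mul_le_mul_of_nonneg_right (holder_const_le hβ hC0 hk hk2) (Real.rpow_nonneg ht.le _)
  have hg : 0 < Real.Gamma (k * β) := Real.Gamma_pos_of_pos hk0
  have hTk : ((KConst β C * T) ^ β) ^ k = L ^ k * T ^ ((k : ℝ) * β) := by
    rw [Real.mul_rpow hK hT.le, mul_pow, ← Real.rpow_natCast (T ^ β), ← Real.rpow_mul hT.le,
      mul_comm β]
  rw [hTk]
  refine hcoef.trans ((mul_le_mul_of_nonneg_left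
    (Real.rpow_le_rpow ht.le htT hk0.le) ?_).trans (le_of_eq ?_))
  · exact div_nonneg (mul_nonneg (inv_nonneg.mpr hg.le) (pow_nonneg hL k)) hα.le
  · field_simp
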